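/- **Setting.** For $k\ge 0$ let $\mathcal S_k$ be the spectraplex of $k$-qubit density matrices (positive semidefinite $2^k\times 2^k$ complex matrices of trace $1$). In a quantum zero-sum game, Alice and Bob send states $\alpha\in\mathcal A=\mathcal S_n$ and $\beta\in\mathcal B=\mathcal S_m$ to a referee, who measures $\alpha\otimes\beta$ with a POVM $\{P_\omega\}_{\omega\in\Omega}$ ($\Omega$ finite). Alice receives $u(\omega)\in[-1,1]$ and Bob $-u(\omega)$. Put $U=\sum_\omega u(\omega)P_\omega$ and $u(\alpha,\beta)=\operatorname{tr}(U^\dagger(\alpha\otimes\beta))$. Let $\|\cdot\|_\infty$ be the operator norm, $\|\cdot\|_1$ the trace norm, and $$F(\alpha,\beta)=\big(\operatorname{tr}_{\mathcal B}[U^\dagger(I\otimes\beta)],\,-\operatorname{tr}_{\mathcal A}[U^\dagger(\alpha\otimes I)]\big)=:(F_{\mathcal A},F_{\mathcal B}).$$ A pair $(\tilde\alpha,\tilde\beta)\in\mathcal A\times\mathcal B$ is an $\epsilon$-Nash equilibrium if $$\max_{\alpha}u(\alpha,\tilde\beta)-\epsilon\|U\|_\infty\le u(\tilde\alpha,\tilde\beta)\le\min_\beta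 u(\tilde\alpha,\beta)+\epsilon\|U\|_\infty .$$ For a regularizer $h$ with Bregman divergence $D_h(X\|Y)=h(X)-h(Y)-\langle\nabla h(Y),X-Y\rangle$ and $\eta>0$, the proximal map on $\mathcal S_k$ is $$\Pi^{h,\eta}(X,Y)=\operatorname{arg\,min}_{C\in\mathcal S_k}\big\{\operatorname{tr}[Y^\dagger(X-C)]+\tfrac1\eta D_h(C\|X)\big\}.$$ OMMP with regularizer $h$ and step size $\eta$ starts at $\Psi_0=\Phi_0=(2^{-n}I,2^{-m}I)$ and iterates, in each of the two components separately, $$\Psi_{t+1}=\Pi^{h,\eta}(\Phi_t,F(\Psi_t)),\qquad \Phi_{t+1}=\Pi^{h,\eta}(\Phi_t,F(\Psi_{t+1})),\qquad t\ge0.$$ Let $h(X)=\operatorname{tr}[X\log X]$ (von Neumann entropy) and $\Lambda(Y)=\exp(Y)/\operatorname{tr}\exp(Y)$. OMMWU with step size $\eta$ is the iteration from the same initial point with the updates $\Psi_{t+1}=\Lambda(\log\Phi_t+\eta F(\Psi_t))$, $\Phi_{t+1}=\Lambda(\log\Phi_t+\eta F(\Psi_{t+1}))$, where $\Lambda$ and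 $\log$ act in each component. Call $\mu$ a strong convexity parameter of $h$ on $\mathcal S_k$ if $D_h(X\|Y)\ge\frac\mu2\|X-Y\|_1^2$ for all $X,Y\in\mathcal S_k$ with $Y$ positive definite, and $\gamma$ a Lipschitz parameter of $F$ if, for all $\alpha,\alpha'\in\mathcal A$ and $\beta,\beta'\in\mathcal B$, $$\max\big(\|F_{\mathcal A}(\beta)-F_{\mathcal A}(\beta')\|_\infty,\|F_{\mathcal B}(\alpha)-F_{\mathcal B}(\alpha')\|_\infty\big)\le\gamma\,(\|\alpha-\alpha'\|_1+\|\beta-\beta'\|_1).$$ **Corollary (OMMWU iteration complexity).** Let $h$ be the von Neumann entropy. 1. For every positive definite $X\in\mathcal S_k$, Hermitian $Y$ and $\eta>0$, the minimum defining $\Pi^{h,\eta}(X,Y)$ is attained exactly at $\Lambda(\log X+\eta Y)$. For every $\eta>0$, OMMP with regularizer $h$ therefore has exactly one run, and it is OMMWU. 2. $\mu=1$ is a strong convexity parameter of $h$ on every $\mathcal S_k$, and $\gamma=\|U\|_\infty$ is a Lipschitz parameter of $F$ for every game. 3. There is a universal constant $K>0$ such that the following holds for every game on $n$ and $m$ qubits,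 with $d=\max(n,m)$ (so that both spectraplexes have dimension at most $4^d$). Let $\mu\ge1$ be a strong convexity parameter of $h$ on $\mathcal A$ and on $\mathcal B$, let $0<\gamma\le\|U\|_\infty$ be a Lipschitz parameter of $F$, and let $\eta=\mu/(2\gamma)$. Then for every $\epsilon>0$ and every integer $T\ge1$ with $T\ge Kd/\epsilon$, both average iterates of OMMWU with step size $\eta$, $\frac1T\sum_{t=0}^{T-1}\Psi_t$ and $\frac1T\sum_{t=1}^{T}\Psi_t$, are $\epsilon$-Nash equilibria. That is, OMMWU computes average-iterate $\epsilon$-Nash equilibria in $O(d/\epsilon)$ iterations. -/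

import Mathlib

open scoped Kronecker ComplexOrder

noncomputable section

namespace QZS

/-- Complex matrices acting on the state space of `k` qubits. -/
abbrev QMat (k : ℕ) : Type := Matrix (Fin (2 ^ k)) (Fin (2 ^ k)) ℂ

/-- Complex matrices acting on the joint state space of `n + m` qubits. -/
abbrev BiMat (n m : ℕ) : Type :=
  Matrix (Fin (2 ^ n) × Fin (2 ^ m)) (Fin (2 ^ n) × Fin (2 ^ m)) ℂ

/-- The spectraplex of `k`-qubit density matrices. -/
def spectraplex (k : ℕ) : Set (QMat k) := {X | X.PosSemidef ∧ X.trace = 1}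

/-- The maximally mixed `k`-qubit state `2⁻ᵏ I`. -/
def maxMixed (k : ℕ) : QMat k := ((2 : ℂ) ^ k)⁻¹ • (1 : QMat k)

section General

variable {ι : Type*} [Fintype ι] [DecidableEq ι]

/-- The operator (Schatten-`∞`, spectral) norm. -/
def opNorm (X : Matrix ι ι ℂ) : ℝ := ‖Matrix.toEuclideanCLM (n := ι) (𝕜 := ℂ) X‖

/-- The trace (Schatten-`1`) norm `tr √(X† X)`. -/
def traceNorm (X : Matrix ι ι ℂ) : ℝ := (cfc Real.sqrt (X.conjTranspose * X)).trace.re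

/-- The logarithm of a Hermitian matrix, by functional calculus. -/
def matLog (X : Matrix ι ι ℂ) : Matrix ι ι ℂ := cfc Real.log X

/-- The logit map `Λ(Y) = exp Y / tr (exp Y)`. -/
def logit (Y : Matrix ι ι ℂ) : Matrix ι ι ℂ :=
  ((NormedSpace.exp Y).trace)⁻¹ • NormedSpace.exp Y

/-- The von Neumann entropy regularizer `h(X) = tr (X log X)`. -/
def vnEntropy (X : Matrix ι ι ℂ) : ℝ := (X * matLog X).trace.re

/-- The Bregman divergence `D_h(X‖Y) = h(X) - h(Y) - ⟨∇h(Y), X - Y⟩`, where `⟨∇h(Y), X - Y⟩` is the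
derivative of `h` at `Y` in the direction `X - Y`. It is used at points `Y` of differentiability. -/
def bregman (h : Matrix ι ι ℂ → ℝ) (X Y : Matrix ι ι ℂ) : ℝ :=
  h X - h Y - lineDeriv ℝ h Y (X - Y)

end General

/-- `h` is `μ`-strongly convex on the `k`-qubit spectraplex with respect to the trace norm:
`D_h(X‖Y) ≥ (μ/2) ‖X - Y‖₁²` for all states `X` and all `Y` in the interior, where `h` is
differentiable. -/
def IsStronglyConvex (k : ℕ) (h : QMat k → ℝ) (μ : ℝ) : Prop :=
  ∀ X ∈ spectraplex k, ∀ Y ∈ spectraplex k, Y.PosDef →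
    μ / 2 * traceNorm (X - Y) ^ 2 ≤ bregman h X Y

/-- `Q` is a value of the proximal map `Π^{h,η}(P, D)`: it attains the minimum over `C` in the
spectraplex of `⟨D, P - C⟩ + (1/η) D_h(C‖P)`. -/
def IsProx {k : ℕ} (h : QMat k → ℝ) (η : ℝ) (P D Q : QMat k) : Prop :=
  Q ∈ spectraplex k ∧ ∀ C ∈ spectraplex k,
    (D.conjTranspose * (P - Q)).trace.re + 1 / η * bregman h Q P ≤
      (D.conjTranspose * (P - C)).trace.re + 1 / η * bregman h C P

/-- A finite-valued quantum zero-sum game: the referee measures the `(n + m)`-qubit product state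
with a POVM indexed by the finite set `Ω`, and outcome `ω` gives Alice the utility `util ω`
and Bob `-util ω`. -/
structure Game (n m : ℕ) (Ω : Type*) [Fintype Ω] where
  povm : Ω → BiMat n m
  povm_posSemidef : ∀ ω, (povm ω).PosSemidef
  povm_sum : ∑ ω, povm ω = 1
  util : Ω → ℝ
  util_mem : ∀ ω, util ω ∈ Set.Icc (-1 : ℝ) 1

/-- The partial trace over the second (Bob's) factor. -/
def ptraceB {n m : ℕ} (M : BiMat n m) : QMat n :=
  Matrix.of fun i i' => ∑ j, M (i, j) (i', j)

/-- The partial trace over the first (Alice's) factor. -/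
def ptraceA {n m : ℕ} (M : BiMat n m) : QMat m :=
  Matrix.of fun j j' => ∑ i, M (i, j) (i, j')

/-- A joint pair of matrices, Alice's and Bob's. -/
abbrev Joint (n m : ℕ) : Type := QMat n × QMat m

/-- The product of the two spectraplexes. -/
def jointStates (n m : ℕ) : Set (Joint n m) := {Z | Z.1 ∈ spectraplex n ∧ Z.2 ∈ spectraplex m}

namespace Game

variable {n m : ℕ} {Ω : Type*} [Fintype Ω] (G : Game n m Ω)

/-- The payoff observable `U = ∑ ω, u(ω) P_ω`. -/
def payoff : BiMat n m := ∑ ω, ((G.util ω : ℝ) : ℂ) • G.povm ω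

/-- Alice's expected payoff `u(α, β) = tr (U† (α ⊗ β))`. -/
def expUtil (α : QMat n) (β : QMat m) : ℝ :=
  (G.payoff.conjTranspose * (α ⊗ₖ β)).trace.re

/-- Alice's payoff gradient `F_α(β) = tr_B (U† (I ⊗ β))`. -/
def gradA (β : QMat m) : QMat n :=
  ptraceB (G.payoff.conjTranspose * ((1 : QMat n) ⊗ₖ β))

/-- Bob's payoff gradient `F_β(α) = - tr_A (U† (α ⊗ I))`. -/
def gradB (α : QMat n) : QMat m :=
  -ptraceA (G.payoff.conjTranspose * (α ⊗ₖ (1 : QMat m)))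

/-- The joint feedback operator `F(α, β) = (F_α(β), F_β(α))`. -/
def grad (Z : Joint n m) : Joint n m := (G.gradA Z.2, G.gradB Z.1)

/-- `F` is `γ`-Lipschitz on the joint state space from the Schatten-`1` norm of the direct sum
to the dual Schatten-`∞` norm of the direct sum. -/
def IsLipschitz (γ : ℝ) : Prop :=
  ∀ Z ∈ jointStates n m, ∀ Z' ∈ jointStates n m,
    max (opNorm ((G.grad Z).1 - (G.grad Z').1)) (opNorm ((G.grad Z).2 - (G.grad Z').2)) ≤
      γ * (traceNorm (Z.1 - Z'.1) + traceNorm (Z.2 - Z'.2))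

/-- `ε`-approximate Nash equilibria:
`max_α u(α, β̃) - ε ‖U‖∞ ≤ u(α̃, β̃) ≤ min_β u(α̃, β) + ε ‖U‖∞`. -/
def IsApproxNash (ε : ℝ) (Z : Joint n m) : Prop :=
  Z ∈ jointStates n m ∧
  (∀ α ∈ spectraplex n,
    G.expUtil α Z.2 - ε * opNorm G.payoff ≤ G.expUtil Z.1 Z.2) ∧
  (∀ β ∈ spectraplex m,
    G.expUtil Z.1 Z.2 ≤ G.expUtil Z.1 β + ε * opNorm G.payoff)

/-- `(Ψ_t)` and `(Φ_t)` are the states and momenta of a run of Optimistic Matrix Mirror Prox with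
regularizers `hA`, `hB` and step size `η`: both start at the maximally mixed states, and
`Ψ_{t+1} = Π(Φ_t, F(Ψ_t))`, `Φ_{t+1} = Π(Φ_t, F(Ψ_{t+1}))`. -/
def IsOMMPRun (hA : QMat n → ℝ) (hB : QMat m → ℝ) (η : ℝ) (Ψ Φ : ℕ → Joint n m) : Prop :=
  Ψ 0 = (maxMixed n, maxMixed m) ∧ Φ 0 = (maxMixed n, maxMixed m) ∧
  ∀ t,
    IsProx hA η (Φ t).1 (G.grad (Ψ t)).1 (Ψ (t + 1)).1 ∧
    IsProx hB η (Φ t).2 (G.grad (Ψ t)).2 (Ψ (t + 1)).2 ∧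
    IsProx hA η (Φ t).1 (G.grad (Ψ (t + 1))).1 (Φ (t + 1)).1 ∧
    IsProx hB η (Φ t).2 (G.grad (Ψ (t + 1))).2 (Φ (t + 1)).2

/-- The exponential update `(α̂, β̂) ↦ (Λ(log α̂ + η Y_α), Λ(log β̂ + η Y_β))`. -/
def expUpdate (η : ℝ) (Φ Y : Joint n m) : Joint n m :=
  (logit (matLog Φ.1 + η • Y.1), logit (matLog Φ.2 + η • Y.2))

/-- The pair (state, momentum) of Optimistic Matrix Multiplicative Weights Update after `t`
iterations with step size `η`. -/
def ommwu (η : ℝ) : ℕ → Joint n m × Joint n m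
  | 0 => ((maxMixed n, maxMixed m), (maxMixed n, maxMixed m))
  | t + 1 =>
    let Ψ := (ommwu η t).1
    let Φ := (ommwu η t).2
    let Ψ' := expUpdate η Φ (G.grad Ψ)
    (Ψ', expUpdate η Φ (G.grad Ψ'))

/-- The OMMWU states `Ψ_t`. -/
def ommwuState (η : ℝ) (t : ℕ) : Joint n m := (G.ommwu η t).1

/-- The OMMWU momenta `Φ_t`. -/
def ommwuMomentum (η : ℝ) (t : ℕ) : Joint n m := (G.ommwu η t).2

/-- The average `(1/T) (Ψ_0 + ⋯ + Ψ_{T-1})`. -/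
def ommwuAverage (η : ℝ) (T : ℕ) : Joint n m :=
  (T : ℝ)⁻¹ • ∑ t ∈ Finset.range T, G.ommwuState η t

/-- The average `(1/T) (Ψ_1 + ⋯ + Ψ_T)`. -/
def ommwuShiftedAverage (η : ℝ) (T : ℕ) : Joint n m :=
  (T : ℝ)⁻¹ • ∑ t ∈ Finset.range T, G.ommwuState η (t + 1)

end Game

end QZS

end

/-!
The argument rests on one formula. If `X` and `Y` are Hermitian with eigenvalues `p`, `q` and
eigenvectors `uᵢ`, `vⱼ`, then the relative entropy `tr X (log X - log Y)`, corrected by the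
traces, is the average with weights `|⟨uᵢ, vⱼ⟩|²` of the scalar Bregman divergences
`p log p - p log q - p + q` (`relEnt_specMat`). Quantum facts thus reduce to scalar ones.

* The scalar divergence dominates `3 (p - q)² / (2 (p + 2 q))` (`scalar_pinsker`). Writing the
  trace norm as a pairing with a unitary and applying Cauchy–Schwarz with weights `p + 2 q` gives
  Pinsker's inequality (`traceNorm_sq_le_relEnt`), that is, strong convexity with parameter `1`.
* The scalar divergence is at most a multiple of `(p - q)²`, so the entropy is differentiable at
  positive definite matrices and its Bregman divergence is the relative entropy
  (`hasDerivAt_vnEntropy`, `bregman_vnEntropy`).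

A logit step tilts the relative entropy by a linear function (`exists_relEnt_logit`). Hence the
proximal objective is, up to a constant, the relative entropy to the logit point, which is its
unique minimizer (`isProx_vnEntropy_iff`). The Lipschitz bound holds because contracting `U` with
a Hermitian matrix is a combination, with its eigenvalues as coefficients, of compressions of `U`
by isometries (`opNorm_contract_right_le`).

For the rate, write `x` for the opponent's move `‖Ψ_{t+1} - Ψ_t‖₁` and `y` for a player's
`‖Φ_{t+1} - Ψ_{t+1}‖₁`. The tilting identities are exact: the symmetrized relative entropy of
`Φ_{t+1}` and `Ψ_{t+1}` equals `η` times the pairing of the change of feedback with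
`Φ_{t+1} - Ψ_{t+1}`, so it is at most `(μ/2) x y`. Strong convexity then gives both `y ≤ x / 2`
and a cost of at most `μ x² / 8` in the regret of the step (`optimistic_step`). Each player's
feedback depends on the opponent alone, so with the triangle inequality through `Φ_t` the costs
are absorbed by the terms `-(μ/2) ‖Ψ_{t+1} - Φ_t‖₁²` and the regret telescopes exactly at the step
size `η = μ/(2γ)` (`Game.sum_gap_le`). What remains is the relative entropy to the maximally mixed
states, at most `(n + m) log 2`. The gap is bilinear, so the average iterate inherits the bound
(`Game.isApproxNash_average`), and shifting the average by one step changes the gap by at most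
`4 ‖U‖∞ / T`.
-/

namespace QZS

open Matrix

/-! ### Spectral decompositions and functional calculus -/

section Spectral

variable {ι : Type*} [Fintype ι] [DecidableEq ι]

/-- The matrix `U diag(d) U†` with orthonormal eigenvectors the columns of `U` and real
eigenvalues `d`. -/
noncomputable def specMat (U : unitaryGroup ι ℂ) (d : ι → ℝ) : Matrix ι ι ℂ :=
  (U : Matrix ι ι ℂ) * diagonal (fun i => (d i : ℂ)) * (U : Matrix ι ι ℂ)ᴴ

theorem conjTranspose_mul_unitary (U : unitaryGroup ι ℂ) :
    (U : Matrix ι ι ℂ)ᴴ * (U : Matrix ι ι ℂ) = 1 :=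
  Unitary.coe_star_mul_self U

theorem unitary_mul_conjTranspose (U : unitaryGroup ι ℂ) :
    (U : Matrix ι ι ℂ) * (U : Matrix ι ι ℂ)ᴴ = 1 :=
  Unitary.coe_mul_star_self U

theorem exists_eq_specMat {A : Matrix ι ι ℂ} (hA : A.IsHermitian) :
    ∃ U d, A = specMat U d :=
  ⟨hA.eigenvectorUnitary, hA.eigenvalues, hA.spectral_theorem⟩

theorem isHermitian_specMat (U : unitaryGroup ι ℂ) (d : ι → ℝ) : (specMat U d).IsHermitian := by
  rw [specMat]
  refine isHermitian_mul_mul_conjTranspose _ ?_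
  rw [isHermitian_diagonal_iff]
  intro i
  simp [IsSelfAdjoint]

theorem specMat_mul_specMat (U : unitaryGroup ι ℂ) (d e : ι → ℝ) :
    specMat U d * specMat U e = specMat U (fun i => d i * e i) := by
  simp only [specMat, Complex.ofReal_mul, ← diagonal_mul_diagonal]
  calc _ = (U : Matrix ι ι ℂ) * diagonal (fun i => (d i : ℂ)) *
        ((U : Matrix ι ι ℂ)ᴴ * (U : Matrix ι ι ℂ)) * diagonal (fun i => (e i : ℂ)) *
        (U : Matrix ι ι ℂ)ᴴ := by simp only [Matrix.mul_assoc]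
    _ = _ := by rw [conjTranspose_mul_unitary]; simp only [Matrix.mul_assoc, Matrix.one_mul]

theorem specMat_add (U : unitaryGroup ι ℂ) (d e : ι → ℝ) :
    specMat U d + specMat U e = specMat U (fun i => d i + e i) := by
  simp only [specMat, Complex.ofReal_add, ← diagonal_add, Matrix.mul_add, Matrix.add_mul]

theorem smul_specMat (U : unitaryGroup ι ℂ) (d : ι → ℝ) (c : ℝ) :
    c • specMat U d = specMat U (fun i => c * d i) := by
  have : diagonal (fun i => ((c * d i : ℝ) : ℂ)) = c • diagonal (fun i => (d i : ℂ)) := by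
    rw [← diagonal_smul]; congr 1; ext i; simp
  simp only [specMat, this, Matrix.mul_smul, Matrix.smul_mul]

theorem specMat_const (U : unitaryGroup ι ℂ) (c : ℝ) :
    specMat U (fun _ => c) = c • (1 : Matrix ι ι ℂ) := by
  have h : specMat U (fun _ => (1 : ℝ)) = 1 := by
    simp [specMat, unitary_mul_conjTranspose]
  rw [← h, smul_specMat]
  simp

theorem trace_mul_specMat (S : Matrix ι ι ℂ) (U : unitaryGroup ι ℂ) (d : ι → ℝ) :
    (S * specMat U d).trace =
      ∑ i, ((U : Matrix ι ι ℂ)ᴴ * S * (U : Matrix ι ι ℂ)) i i * (d i : ℂ) := by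
  rw [specMat, ← Matrix.mul_assoc, trace_mul_comm, ← Matrix.mul_assoc, ← Matrix.mul_assoc, trace]
  simp [mul_diagonal]

theorem trace_specMat (U : unitaryGroup ι ℂ) (d : ι → ℝ) :
    (specMat U d).trace = ((∑ i, d i : ℝ) : ℂ) := by
  have := trace_mul_specMat 1 U d
  simpa [conjTranspose_mul_unitary] using this

/-- The functional calculus may be computed in any orthonormal eigenbasis: the change of basis to
Mathlib's chosen one only links equal eigenvalues. -/
theorem cfc_specMat (f : ℝ → ℝ) (U : unitaryGroup ι ℂ) (d : ι → ℝ) :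
    cfc f (specMat U d) = specMat U (fun i => f (d i)) := by
  have hA := isHermitian_specMat U d
  rw [hA.cfc_eq]
  change specMat hA.eigenvectorUnitary (fun i => f (hA.eigenvalues i)) = _
  have hs : specMat hA.eigenvectorUnitary hA.eigenvalues = specMat U d := hA.spectral_theorem.symm
  generalize hA.eigenvectorUnitary = V at hs ⊢
  generalize hA.eigenvalues = e at hs ⊢
  simp only [specMat] at hs ⊢
  set u := (U : Matrix ι ι ℂ)
  set v := (V : Matrix ι ι ℂ)
  have hu : uᴴ * u = 1 := conjTranspose_mul_unitary U
  have hu' : u * uᴴ = 1 := unitary_mul_conjTranspose U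
  have hv : vᴴ * v = 1 := conjTranspose_mul_unitary V
  have hv' : v * vᴴ = 1 := unitary_mul_conjTranspose V
  have h1 : diagonal (fun i => (e i : ℂ)) * (vᴴ * u) =
      (vᴴ * u) * diagonal (fun i => (d i : ℂ)) := by
    calc _ = (vᴴ * v) * diagonal (fun i => (e i : ℂ)) * (vᴴ * u) := by rw [hv, Matrix.one_mul]
      _ = vᴴ * (v * diagonal (fun i => (e i : ℂ)) * vᴴ) * u := by simp only [Matrix.mul_assoc]
      _ = vᴴ * (u * diagonal (fun i => (d i : ℂ)) * uᴴ) * u := by rw [hs]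
      _ = (vᴴ * u) * diagonal (fun i => (d i : ℂ)) * (uᴴ * u) := by simp only [Matrix.mul_assoc]
      _ = _ := by rw [hu, Matrix.mul_one]
  have h2 : diagonal (fun i => (f (e i) : ℂ)) * (vᴴ * u) =
      (vᴴ * u) * diagonal (fun i => (f (d i) : ℂ)) := by
    ext i j
    have := congrFun (congrFun h1 i) j
    rw [diagonal_mul, mul_diagonal] at this ⊢
    by_cases h0 : (vᴴ * u) i j = 0
    · simp [h0]
    · have : e i = d j := by
        rw [mul_comm] at this
        exact_mod_cast mul_left_cancel₀ h0 this
      rw [this, mul_comm]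
  calc _ = v * (diagonal (fun i => (f (e i) : ℂ)) * vᴴ) * (u * uᴴ) := by
        rw [hu', Matrix.mul_one, Matrix.mul_assoc]
    _ = v * (diagonal (fun i => (f (e i) : ℂ)) * (vᴴ * u)) * uᴴ := by simp only [Matrix.mul_assoc]
    _ = (v * vᴴ) * u * diagonal (fun i => (f (d i) : ℂ)) * uᴴ := by
        rw [h2]; simp only [Matrix.mul_assoc]
    _ = _ := by rw [hv', Matrix.one_mul]

theorem conjTranspose_specMat_mul_self (U : unitaryGroup ι ℂ) (d : ι → ℝ) :
    (specMat U d)ᴴ * specMat U d = specMat U (fun i => d i * d i) := by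
  rw [(isHermitian_specMat U d).eq, specMat_mul_specMat]

theorem traceNorm_specMat (U : unitaryGroup ι ℂ) (d : ι → ℝ) :
    traceNorm (specMat U d) = ∑ i, |d i| := by
  rw [traceNorm, conjTranspose_specMat_mul_self, cfc_specMat, trace_specMat, Complex.ofReal_re]
  simp [Real.sqrt_mul_self_eq_abs]

theorem matLog_specMat (U : unitaryGroup ι ℂ) (d : ι → ℝ) :
    matLog (specMat U d) = specMat U (fun i => Real.log (d i)) :=
  cfc_specMat _ U d

theorem isHermitian_matLog {A : Matrix ι ι ℂ} (hA : A.IsHermitian) : (matLog A).IsHermitian := by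
  obtain ⟨U, d, rfl⟩ := exists_eq_specMat hA
  rw [matLog_specMat]
  exact isHermitian_specMat _ _

theorem exp_specMat (U : unitaryGroup ι ℂ) (d : ι → ℝ) :
    NormedSpace.exp (specMat U d) = specMat U (fun i => Real.exp (d i)) := by
  have hinv : (U : Matrix ι ι ℂ)⁻¹ = (U : Matrix ι ι ℂ)ᴴ :=
    inv_eq_left_inv (conjTranspose_mul_unitary U)
  have hU : IsUnit (U : Matrix ι ι ℂ) :=
    ⟨⟨_, _, unitary_mul_conjTranspose U, conjTranspose_mul_unitary U⟩, rfl⟩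
  rw [specMat, ← hinv, Matrix.exp_conj _ _ hU, exp_diagonal, hinv, specMat]
  congr 3
  ext i
  rw [Pi.coe_exp, ← Complex.exp_eq_exp_ℂ, Complex.ofReal_exp]

theorem posSemidef_specMat (U : unitaryGroup ι ℂ) (d : ι → ℝ) :
    (specMat U d).PosSemidef ↔ ∀ i, 0 ≤ d i := by
  have hU : IsUnit (U : Matrix ι ι ℂ) :=
    ⟨⟨_, _, unitary_mul_conjTranspose U, conjTranspose_mul_unitary U⟩, rfl⟩
  rw [specMat, ← star_eq_conjTranspose, hU.posSemidef_star_right_conjugate_iff,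
    posSemidef_diagonal_iff]
  simp

theorem posDef_specMat (U : unitaryGroup ι ℂ) (d : ι → ℝ) :
    (specMat U d).PosDef ↔ ∀ i, 0 < d i := by
  have hU : IsUnit (U : Matrix ι ι ℂ) :=
    ⟨⟨_, _, unitary_mul_conjTranspose U, conjTranspose_mul_unitary U⟩, rfl⟩
  rw [specMat, ← star_eq_conjTranspose, hU.posDef_star_right_conjugate_iff,
    posDef_diagonal_iff]
  simp

end Spectral

/-! ### Scalar inequalities and relative entropy in eigenbases -/

section Scalar

/-- A lower bound on the logarithm that is sharp to third order at `1`. The difference of the two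
sides has derivative `(x - 1)³ / (x² (x + 2)²)`. -/
theorem sharp_log_lower_bound {x : ℝ} (hx : 0 < x) :
    3 * (x - 1) ^ 2 / (2 * (x + 2)) ≤ x * Real.log x - x + 1 := by
  set g : ℝ → ℝ := fun x => Real.log x - 1 + 1 / x - 3 * (x - 1) ^ 2 / (2 * x * (x + 2)) with hg
  have hderiv : ∀ y : ℝ, 0 < y → HasDerivAt g ((y - 1) ^ 3 / (y ^ 2 * (y + 2) ^ 2)) y := by
    intro y hy
    have h1 := (Real.hasDerivAt_log hy.ne').sub_const 1
    have h2 := (hasDerivAt_inv hy.ne')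
    have h3 : HasDerivAt (fun x : ℝ => 3 * (x - 1) ^ 2) (3 * (2 * (y - 1))) y := by
      have := (((hasDerivAt_id y).sub_const 1).pow 2).const_mul 3
      simpa using this
    have h4 : HasDerivAt (fun x : ℝ => 2 * x * (x + 2)) (4 * y + 4) y := by
      have := ((hasDerivAt_id y).const_mul 2).mul ((hasDerivAt_id y).add_const 2)
      refine this.congr_deriv ?_
      simp only [id]
      ring
    have h5 := (h1.add h2).sub (h3.div h4 (by positivity))
    have : g = fun x => (Real.log x - 1 + x⁻¹) - 3 * (x - 1) ^ 2 / (2 * x * (x + 2)) := by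
      ext x; simp [hg]
    rw [this]
    refine h5.congr_deriv ?_
    field_simp
    ring
  have hg1 : g 1 = 0 := by simp [hg]
  have key : 0 ≤ g x := by
    rcases le_total 1 x with h | h
    · have : MonotoneOn g (Set.Ici 1) := by
        refine monotoneOn_of_deriv_nonneg (convex_Ici 1)
          (fun y hy => (hderiv y (lt_of_lt_of_le one_pos hy)).continuousAt.continuousWithinAt)
          (fun y hy => ?_) (fun y hy => ?_)
        all_goals rw [interior_Ici] at hy; have hy : 1 < y := hy
        · exact (hderiv y (by linarith)).differentiableAt.differentiableWithinAt
        · rw [(hderiv y (by linarith)).deriv]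
          have : 0 < y - 1 := by linarith
          positivity
      rw [← hg1]
      exact this (Set.mem_Ici.2 le_rfl) h h
    · have : AntitoneOn g (Set.Ioc 0 1) := by
        refine antitoneOn_of_deriv_nonpos (convex_Ioc 0 1)
          (fun y hy => (hderiv y hy.1).continuousAt.continuousWithinAt)
          (fun y hy => ?_) (fun y hy => ?_)
        all_goals rw [interior_Ioc] at hy
        · exact (hderiv y hy.1).differentiableAt.differentiableWithinAt
        · rw [(hderiv y hy.1).deriv]
          refine div_nonpos_of_nonpos_of_nonneg ?_ (by positivity)
          exact Odd.pow_nonpos (by decide) (by linarith [hy.2])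
      rw [← hg1]
      exact this ⟨hx, h⟩ ⟨one_pos, le_rfl⟩ h
  have h := mul_nonneg hx.le key
  have e : x * g x = (x * Real.log x - x + 1) - 3 * (x - 1) ^ 2 / (2 * (x + 2)) := by
    simp only [hg]
    field_simp
  linarith

/-- The Bregman divergence of `x ↦ x log x` dominates a weighted square, with the weights that
turn Cauchy–Schwarz into Pinsker's inequality. -/
theorem scalar_pinsker {p q : ℝ} (hp : 0 ≤ p) (hq : 0 < q) :
    3 * (p - q) ^ 2 / (2 * (p + 2 * q)) ≤ p * Real.log p - p * Real.log q - p + q := by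
  rcases hp.eq_or_lt with rfl | hp
  · simp
    rw [div_le_iff₀ (by positivity)]
    nlinarith
  · have h := mul_le_mul_of_nonneg_left (sharp_log_lower_bound (div_pos hp hq)) hq.le
    rw [Real.log_div hp.ne' hq.ne'] at h
    have e1 : q * (3 * (p / q - 1) ^ 2 / (2 * (p / q + 2))) =
        3 * (p - q) ^ 2 / (2 * (p + 2 * q)) := by
      field_simp
    have e2 : q * (p / q * (Real.log p - Real.log q) - p / q + 1) =
        p * Real.log p - p * Real.log q - p + q := by
      field_simp
    linarith

/-- A quadratic bound on the remainder of `x log x` at `1`, valid for every real `x` because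
`Real.log x = log |x|`. -/
theorem abs_mul_log_sub_le (x : ℝ) : |x * Real.log x - x + 1| ≤ 2 * (x - 1) ^ 2 := by
  rcases lt_trichotomy x 0 with hx | rfl | hx
  · have h1 : Real.log x ≤ -x - 1 := by
      have := Real.log_le_sub_one_of_pos (neg_pos.2 hx)
      rwa [Real.log_neg_eq_log] at this
    have h2 : 1 - (-x)⁻¹ ≤ Real.log x := by
      have := Real.one_sub_inv_le_log_of_pos (neg_pos.2 hx)
      rwa [Real.log_neg_eq_log] at this
    have h3 : x * Real.log x ≤ x + 1 := by
      have := mul_le_mul_of_nonpos_left h2 hx.le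
      have e : x * (1 - (-x)⁻¹) = x + 1 := by field_simp [hx.ne]; ring
      linarith
    have h4 : x * (-x - 1) ≤ x * Real.log x := mul_le_mul_of_nonpos_left h1 hx.le
    rw [abs_le]
    constructor <;> nlinarith
  · norm_num
  · have h1 : Real.log x ≤ x - 1 := Real.log_le_sub_one_of_pos hx
    have h2 : 1 - x⁻¹ ≤ Real.log x := Real.one_sub_inv_le_log_of_pos hx
    have h3 : x - 1 ≤ x * Real.log x := by
      have := mul_le_mul_of_nonneg_left h2 hx.le
      have e : x * (1 - x⁻¹) = x - 1 := by field_simp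
      linarith
    have h4 : x * Real.log x ≤ x * (x - 1) := mul_le_mul_of_nonneg_left h1 hx.le
    rw [abs_le]
    constructor <;> nlinarith

theorem abs_scalar_bregman_le (p : ℝ) {q : ℝ} (hq : 0 < q) :
    |p * Real.log p - p * Real.log q - p + q| ≤ 2 / q * (p - q) ^ 2 := by
  have h := mul_le_mul_of_nonneg_left (abs_mul_log_sub_le (p / q)) hq.le
  have e1 : q * |p / q * Real.log (p / q) - p / q + 1| =
      |p * Real.log p - p * Real.log q - p + q| := by
    rw [← abs_of_pos hq, ← abs_mul, abs_of_pos hq]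
    rcases eq_or_ne p 0 with rfl | hp
    · simp
    · rw [Real.log_div hp hq.ne']
      congr 1
      field_simp
  have e2 : q * (2 * (p / q - 1) ^ 2) = 2 / q * (p - q) ^ 2 := by
    field_simp
  linarith

end Scalar

section Overlap

variable {ι : Type*} [Fintype ι] [DecidableEq ι]

/-- The overlaps `|⟨uᵢ, vⱼ⟩|²` of two orthonormal bases. -/
noncomputable def overlap (U V : unitaryGroup ι ℂ) (i j : ι) : ℝ :=
  ‖((U : Matrix ι ι ℂ)ᴴ * (V : Matrix ι ι ℂ)) i j‖ ^ 2

theorem overlap_nonneg (U V : unitaryGroup ι ℂ) (i j : ι) : 0 ≤ overlap U V i j := by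
  unfold overlap; positivity

theorem sum_norm_sq_row {M : Matrix ι ι ℂ} (hM : M * Mᴴ = 1) (i : ι) :
    ∑ j, ‖M i j‖ ^ 2 = 1 := by
  have := congrFun (congrFun hM i) i
  simp only [mul_apply, conjTranspose_apply, one_apply_eq, RCLike.star_def, RCLike.mul_conj] at this
  exact Complex.ofReal_injective (by push_cast; exact this)

theorem sum_norm_sq_col {M : Matrix ι ι ℂ} (hM : Mᴴ * M = 1) (j : ι) :
    ∑ i, ‖M i j‖ ^ 2 = 1 := by
  have := congrFun (congrFun hM j) j
  simp only [mul_apply, conjTranspose_apply, one_apply_eq, RCLike.star_def, RCLike.conj_mul] at this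
  exact Complex.ofReal_injective (by push_cast; exact this)

theorem unitary_conj_mul (U V : unitaryGroup ι ℂ) :
    ((U : Matrix ι ι ℂ)ᴴ * (V : Matrix ι ι ℂ)) * ((U : Matrix ι ι ℂ)ᴴ * (V : Matrix ι ι ℂ))ᴴ = 1 :=
  unitary_mul_conjTranspose (star U * V)

theorem unitary_conj_mul' (U V : unitaryGroup ι ℂ) :
    ((U : Matrix ι ι ℂ)ᴴ * (V : Matrix ι ι ℂ))ᴴ * ((U : Matrix ι ι ℂ)ᴴ * (V : Matrix ι ι ℂ)) = 1 :=
  conjTranspose_mul_unitary (star U * V)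

theorem sum_overlap_right (U V : unitaryGroup ι ℂ) (i : ι) : ∑ j, overlap U V i j = 1 :=
  sum_norm_sq_row (unitary_conj_mul U V) i

theorem sum_overlap_left (U V : unitaryGroup ι ℂ) (j : ι) : ∑ i, overlap U V i j = 1 :=
  sum_norm_sq_col (unitary_conj_mul' U V) j

theorem trace_specMat_mul_specMat (U V : unitaryGroup ι ℂ) (p q : ι → ℝ) :
    (specMat U p * specMat V q).trace = ((∑ i, ∑ j, overlap U V i j * (p i * q j) : ℝ) : ℂ) := by
  rw [trace_mul_specMat, Finset.sum_comm]
  push_cast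
  refine Finset.sum_congr rfl fun j _ => ?_
  have : (V : Matrix ι ι ℂ)ᴴ * specMat U p * (V : Matrix ι ι ℂ) =
      ((U : Matrix ι ι ℂ)ᴴ * (V : Matrix ι ι ℂ))ᴴ * (diagonal (fun i => (p i : ℂ)) *
        ((U : Matrix ι ι ℂ)ᴴ * (V : Matrix ι ι ℂ))) := by
    rw [specMat, conjTranspose_mul, conjTranspose_conjTranspose]
    simp only [Matrix.mul_assoc]
  rw [this, mul_apply, Finset.sum_mul]
  refine Finset.sum_congr rfl fun i _ => ?_
  rw [diagonal_mul, conjTranspose_apply, overlap, RCLike.star_def, Complex.ofReal_pow,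
    ← Complex.conj_mul']
  ring

/-- Sums over one spectrum are sums over pairs of eigenvectors, weighted by the overlaps. -/
theorem sum_eq_sum_overlap_left (U V : unitaryGroup ι ℂ) (p : ι → ℝ) :
    ∑ i, p i = ∑ i, ∑ j, overlap U V i j * p i := by
  refine Finset.sum_congr rfl fun i _ => ?_
  rw [← Finset.sum_mul, sum_overlap_right, one_mul]

theorem sum_eq_sum_overlap_right (U V : unitaryGroup ι ℂ) (q : ι → ℝ) :
    ∑ j, q j = ∑ i, ∑ j, overlap U V i j * q j := by
  rw [Finset.sum_comm]
  refine Finset.sum_congr rfl fun i _ => ?_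
  rw [← Finset.sum_mul, sum_overlap_left, one_mul]

/-- The quantum relative entropy `tr X (log X - log Y)`. -/
noncomputable def relEnt (X Y : Matrix ι ι ℂ) : ℝ :=
  vnEntropy X - (X * matLog Y).trace.re

theorem vnEntropy_specMat (U : unitaryGroup ι ℂ) (p : ι → ℝ) :
    vnEntropy (specMat U p) = ∑ i, p i * Real.log (p i) := by
  rw [vnEntropy, matLog_specMat, specMat_mul_specMat, trace_specMat, Complex.ofReal_re]

/-- Relative entropy as an average, over pairs of eigenvectors weighted by their overlaps, of the
Bregman divergences of the scalar function `x ↦ x log x`. -/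
theorem relEnt_specMat (U V : unitaryGroup ι ℂ) (p q : ι → ℝ) :
    relEnt (specMat U p) (specMat V q) - (specMat U p).trace.re + (specMat V q).trace.re =
      ∑ i, ∑ j, overlap U V i j *
        (p i * Real.log (p i) - p i * Real.log (q j) - p i + q j) := by
  rw [relEnt, vnEntropy_specMat, matLog_specMat, trace_specMat_mul_specMat, trace_specMat,
    trace_specMat, Complex.ofReal_re, Complex.ofReal_re, Complex.ofReal_re,
    sum_eq_sum_overlap_left U V p, sum_eq_sum_overlap_right U V q,
    sum_eq_sum_overlap_left U V (fun i => p i * Real.log (p i))]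
  simp only [← Finset.sum_sub_distrib, ← Finset.sum_add_distrib]
  refine Finset.sum_congr rfl fun i _ => Finset.sum_congr rfl fun j _ => ?_
  ring

end Overlap

/-! ### Trace norm duality, Pinsker's inequality and the gradient of the entropy -/

section Norms

variable {ι : Type*} [Fintype ι] [DecidableEq ι]

open scoped Matrix.Norms.L2Operator in
theorem opNorm_eq_norm (A : Matrix ι ι ℂ) : opNorm A = ‖A‖ := rfl

theorem opNorm_nonneg (A : Matrix ι ι ℂ) : 0 ≤ opNorm A := norm_nonneg _

open scoped Matrix.Norms.L2Operator in
theorem norm_apply_le_opNorm (A : Matrix ι ι ℂ) (i j : ι) : ‖A i j‖ ≤ opNorm A := by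
  have h := l2_opNorm_mulVec A (EuclideanSpace.single j (1 : ℂ))
  have h2 := PiLp.norm_apply_le
    (WithLp.toLp 2 (A *ᵥ (EuclideanSpace.single j (1 : ℂ)).ofLp) : EuclideanSpace ℂ ι) i
  rw [PiLp.norm_single, norm_one, mul_one] at h
  have e : (WithLp.toLp 2 (A *ᵥ (EuclideanSpace.single j (1 : ℂ)).ofLp) : EuclideanSpace ℂ ι) i
      = A i j := by
    simp
  rw [e] at h2
  exact h2.trans h

open scoped Matrix.Norms.L2Operator in
theorem opNorm_conj_le (S : Matrix ι ι ℂ) (U : unitaryGroup ι ℂ) :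
    opNorm ((U : Matrix ι ι ℂ)ᴴ * S * (U : Matrix ι ι ℂ)) ≤ opNorm S := by
  rw [opNorm_eq_norm, opNorm_eq_norm, CStarRing.norm_mul_coe_unitary]
  exact (CStarRing.norm_coe_unitary_mul (star U) S).le

open scoped Matrix.Norms.L2Operator in
theorem opNorm_unitary_le (U : unitaryGroup ι ℂ) : opNorm (U : Matrix ι ι ℂ) ≤ 1 := by
  rcases subsingleton_or_nontrivial (Matrix ι ι ℂ) with h | h
  · rw [opNorm_eq_norm, Subsingleton.elim (U : Matrix ι ι ℂ) 0, norm_zero]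
    exact zero_le_one
  · exact (CStarRing.norm_coe_unitary U).le

/-- Hölder's inequality between the operator norm and the trace norm. -/
theorem abs_re_trace_mul_le (S : Matrix ι ι ℂ) {M : Matrix ι ι ℂ} (hM : M.IsHermitian) :
    |(S * M).trace.re| ≤ opNorm S * traceNorm M := by
  obtain ⟨U, d, rfl⟩ := exists_eq_specMat hM
  rw [traceNorm_specMat, trace_mul_specMat, Finset.mul_sum]
  refine (Complex.abs_re_le_norm _).trans ((norm_sum_le _ _).trans
    (Finset.sum_le_sum fun i _ => ?_))
  rw [norm_mul, Complex.norm_real, Real.norm_eq_abs]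
  exact mul_le_mul_of_nonneg_right ((norm_apply_le_opNorm _ i i).trans (opNorm_conj_le S U))
    (abs_nonneg _)

theorem specMat_mem_unitaryGroup (U : unitaryGroup ι ℂ) {s : ι → ℝ} (hs : ∀ i, s i * s i = 1) :
    specMat U s ∈ unitaryGroup ι ℂ := by
  rw [mem_unitaryGroup_iff, star_eq_conjTranspose, (isHermitian_specMat U s).eq,
    specMat_mul_specMat]
  simp only [hs, specMat_const, one_smul]

/-- The trace norm of a Hermitian matrix is attained by pairing it with the unitary matrix of the
signs of its eigenvalues. -/
theorem exists_unitary_traceNorm {M : Matrix ι ι ℂ} (hM : M.IsHermitian) :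
    ∃ S : unitaryGroup ι ℂ, traceNorm M = ((S : Matrix ι ι ℂ) * M).trace.re := by
  obtain ⟨U, d, rfl⟩ := exists_eq_specMat hM
  refine ⟨⟨specMat U (fun i => if 0 ≤ d i then 1 else -1),
    specMat_mem_unitaryGroup U fun i => by split_ifs <;> norm_num⟩, ?_⟩
  rw [specMat_mul_specMat, trace_specMat, Complex.ofReal_re, traceNorm_specMat]
  refine Finset.sum_congr rfl fun i _ => ?_
  split_ifs with h
  · rw [abs_of_nonneg h, one_mul]
  · rw [abs_of_neg (not_le.1 h), neg_one_mul]

theorem traceNorm_nonneg {M : Matrix ι ι ℂ} (hM : M.IsHermitian) : 0 ≤ traceNorm M := by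
  obtain ⟨U, d, rfl⟩ := exists_eq_specMat hM
  rw [traceNorm_specMat]
  positivity

theorem traceNorm_add_le {M N : Matrix ι ι ℂ} (hM : M.IsHermitian) (hN : N.IsHermitian) :
    traceNorm (M + N) ≤ traceNorm M + traceNorm N := by
  obtain ⟨S, hS⟩ := exists_unitary_traceNorm (hM.add hN)
  have h1 : ∀ {L : Matrix ι ι ℂ}, L.IsHermitian → ((S : Matrix ι ι ℂ) * L).trace.re ≤ traceNorm L :=
    fun hL => (le_abs_self _).trans ((abs_re_trace_mul_le _ hL).trans
      (mul_le_of_le_one_left (traceNorm_nonneg hL) (opNorm_unitary_le S)))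
  rw [hS, Matrix.mul_add, trace_add, Complex.add_re]
  exact add_le_add (h1 hM) (h1 hN)

theorem traceNorm_sub_comm {M N : Matrix ι ι ℂ} : traceNorm (M - N) = traceNorm (N - M) := by
  have : (M - N)ᴴ * (M - N) = (N - M)ᴴ * (N - M) := by
    rw [← neg_sub N M, conjTranspose_neg, neg_mul_neg]
  rw [traceNorm, traceNorm, this]

theorem eq_zero_of_traceNorm_eq_zero {M : Matrix ι ι ℂ} (hM : M.IsHermitian)
    (h : traceNorm M = 0) : M = 0 := by
  obtain ⟨U, d, rfl⟩ := exists_eq_specMat hM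
  rw [traceNorm_specMat, Finset.sum_eq_zero_iff_of_nonneg fun i _ => abs_nonneg _] at h
  have : d = fun _ => 0 := funext fun i => abs_eq_zero.1 (h i (Finset.mem_univ i))
  rw [this, specMat_const, zero_smul]

/-- Pairing a difference of two Hermitian matrices with `S`, in the two eigenbases. -/
theorem trace_mul_specMat_sub (S : Matrix ι ι ℂ) (U V : unitaryGroup ι ℂ) (p q : ι → ℝ) :
    (S * (specMat U p - specMat V q)).trace =
      ∑ i, ∑ j, ((V : Matrix ι ι ℂ)ᴴ * S * (U : Matrix ι ι ℂ)) j i *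
        ((U : Matrix ι ι ℂ)ᴴ * (V : Matrix ι ι ℂ)) i j * ((p i - q j : ℝ) : ℂ) := by
  have hV := unitary_mul_conjTranspose V
  have hU := unitary_mul_conjTranspose U
  set u := (U : Matrix ι ι ℂ)
  set v := (V : Matrix ι ι ℂ)
  have h1 : (S * specMat U p).trace =
      ((diagonal fun i => (p i : ℂ)) * (uᴴ * v) * (vᴴ * S * u)).trace := by
    calc (S * specMat U p).trace
        = (v * vᴴ * (S * u * ((diagonal fun i => (p i : ℂ)) * uᴴ))).trace := by
          rw [hV, Matrix.one_mul, specMat]; simp only [u, Matrix.mul_assoc]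
      _ = ((vᴴ * S * u) * ((diagonal fun i => (p i : ℂ)) * (uᴴ * v))).trace := by
          rw [Matrix.mul_assoc, trace_mul_comm]; simp only [Matrix.mul_assoc]
      _ = _ := by rw [trace_mul_comm]
  have h2 : (S * specMat V q).trace =
      ((uᴴ * v) * (diagonal fun i => (q i : ℂ)) * (vᴴ * S * u)).trace := by
    calc (S * specMat V q).trace
        = (S * (u * uᴴ) * (v * (diagonal fun i => (q i : ℂ)) * vᴴ)).trace := by
          rw [hU, Matrix.mul_one, specMat]
      _ = ((S * u) * ((uᴴ * v) * (diagonal fun i => (q i : ℂ)) * vᴴ)).trace := by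
          simp only [Matrix.mul_assoc]
      _ = _ := by rw [trace_mul_comm]; simp only [Matrix.mul_assoc]
  rw [Matrix.mul_sub, trace_sub, h1, h2]
  simp only [trace, diag_apply]
  rw [← Finset.sum_sub_distrib]
  refine Finset.sum_congr rfl fun i _ => ?_
  rw [mul_apply, mul_apply, ← Finset.sum_sub_distrib]
  refine Finset.sum_congr rfl fun j _ => ?_
  rw [diagonal_mul, mul_diagonal]
  push_cast
  ring

/-- Pinsker's inequality for the quantum relative entropy. In the eigenbases of the two states it
reduces to the scalar inequality and one application of Cauchy–Schwarz with weights `pᵢ + 2 qⱼ`. -/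
theorem traceNorm_sq_le_relEnt {X Y : Matrix ι ι ℂ} (hX : X.PosSemidef) (hY : Y.PosDef)
    (hX1 : X.trace = 1) (hY1 : Y.trace = 1) :
    1 / 2 * traceNorm (X - Y) ^ 2 ≤ relEnt X Y := by
  obtain ⟨S, hS⟩ := exists_unitary_traceNorm (hX.isHermitian.sub hY.isHermitian)
  obtain ⟨U, p, rfl⟩ := exists_eq_specMat hX.isHermitian
  obtain ⟨V, q, rfl⟩ := exists_eq_specMat hY.isHermitian
  have hp := (posSemidef_specMat U p).1 hX
  have hq := (posDef_specMat V q).1 hY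
  have hD := relEnt_specMat U V p q
  rw [hX1, hY1] at hD
  simp only [sub_add_cancel] at hD
  have hp1 : ∑ i, p i = 1 := by rw [trace_specMat] at hX1; exact_mod_cast hX1
  have hq1 : ∑ i, q i = 1 := by rw [trace_specMat] at hY1; exact_mod_cast hY1
  set W : Matrix ι ι ℂ := (U : Matrix ι ι ℂ)ᴴ * (V : Matrix ι ι ℂ) with hW
  set M : Matrix ι ι ℂ := (V : Matrix ι ι ℂ)ᴴ * (S : Matrix ι ι ℂ) * (U : Matrix ι ι ℂ) with hM
  have hM1 : M * Mᴴ = 1 := unitary_mul_conjTranspose (star V * S * U)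
  have hM2 : Mᴴ * M = 1 := conjTranspose_mul_unitary (star V * S * U)
  set r : ι × ι → ℝ := fun x => ‖M x.2 x.1‖ * ‖W x.1 x.2‖ * |p x.1 - q x.2| with hr
  set f : ι × ι → ℝ := fun x => ‖W x.1 x.2‖ ^ 2 * ((p x.1 - q x.2) ^ 2 / (p x.1 + 2 * q x.2))
    with hf
  set g : ι × ι → ℝ := fun x => ‖M x.2 x.1‖ ^ 2 * (p x.1 + 2 * q x.2) with hg
  have hpos : ∀ i j, 0 < p i + 2 * q j := fun i j => by linarith [hp i, hq j]
  have htr : traceNorm (specMat U p - specMat V q) ≤ ∑ x, r x := by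
    rw [hS, trace_mul_specMat_sub, Fintype.sum_prod_type]
    refine (Complex.re_le_norm _).trans ((norm_sum_le _ _).trans (Finset.sum_le_sum fun i _ => ?_))
    refine (norm_sum_le _ _).trans (Finset.sum_le_sum fun j _ => ?_)
    rw [norm_mul, norm_mul, Complex.norm_real, Real.norm_eq_abs]
  have hcs : (∑ x, r x) ^ 2 ≤ (∑ x, f x) * ∑ x, g x := by
    refine Finset.sum_sq_le_sum_mul_sum_of_sq_le_mul _ (fun x _ => ?_) (fun x _ => ?_)
      fun x _ => ?_
    · have := hpos x.1 x.2
      positivity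
    · have := hpos x.1 x.2
      positivity
    · have := (hpos x.1 x.2).ne'
      refine le_of_eq ?_
      simp only [hr, hf, hg, mul_pow, sq_abs]
      generalize p x.1 + 2 * q x.2 = a at this ⊢
      field_simp
  have hgsum : ∑ x, g x = 3 := by
    have h1 : ∑ i, ∑ j, ‖M j i‖ ^ 2 * p i = 1 := by
      simp_rw [← Finset.sum_mul, sum_norm_sq_col hM2, one_mul, hp1]
    have h2 : ∑ i, ∑ j, ‖M j i‖ ^ 2 * q j = 1 := by
      rw [Finset.sum_comm]
      simp_rw [← Finset.sum_mul, sum_norm_sq_row hM1, one_mul, hq1]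
    rw [Fintype.sum_prod_type]
    have : ∀ i j, g (i, j) = ‖M j i‖ ^ 2 * p i + 2 * (‖M j i‖ ^ 2 * q j) := fun i j => by
      simp only [hg]; ring
    simp only [this, Finset.sum_add_distrib, ← Finset.mul_sum, h1, h2]
    norm_num
  have hfsum : 3 / 2 * ∑ x, f x ≤ relEnt (specMat U p) (specMat V q) := by
    rw [hD, Fintype.sum_prod_type, Finset.mul_sum]
    refine Finset.sum_le_sum fun i _ => ?_
    rw [Finset.mul_sum]
    refine Finset.sum_le_sum fun j _ => ?_
    have h := mul_le_mul_of_nonneg_left (scalar_pinsker (hp i) (hq j)) (overlap_nonneg U V i j)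
    refine le_trans (le_of_eq ?_) h
    have := (hpos i j).ne'
    simp only [hf, overlap, hW]
    field_simp
  have h0 := traceNorm_nonneg (hX.isHermitian.sub hY.isHermitian)
  have : traceNorm (specMat U p - specMat V q) ^ 2 ≤ (∑ x, r x) ^ 2 :=
    pow_le_pow_left₀ h0 htr 2
  rw [hgsum] at hcs
  linarith

end Norms

section Derivative

variable {ι : Type*} [Fintype ι] [DecidableEq ι]

/-- `vnEntropy` is differentiable at a positive definite `Y` along Hermitian directions, with
gradient `log Y + 1`: the first-order remainder is an average of scalar remainders, hence at most
quadratic. -/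
theorem hasDerivAt_vnEntropy {Y H : Matrix ι ι ℂ} (hY : Y.PosDef) (hH : H.IsHermitian) :
    HasDerivAt (fun t : ℝ => vnEntropy (Y + t • H)) ((H * matLog Y).trace.re + H.trace.re) 0 := by
  obtain ⟨V, q, rfl⟩ := exists_eq_specMat hY.isHermitian
  have hq := (posDef_specMat V q).1 hY
  set Y := specMat V q
  set C : ℝ := ∑ j, 2 / q j with hC
  have hle : ∀ j, 2 / q j ≤ C := fun j =>
    Finset.single_le_sum (f := fun j => 2 / q j) (fun j _ => (div_pos two_pos (hq j)).le)
      (Finset.mem_univ j)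
  set c : ℝ := (H * H).trace.re
  have key : ∀ t : ℝ, |vnEntropy (Y + t • H) - vnEntropy Y -
      t * ((H * matLog Y).trace.re + H.trace.re)| ≤ C * c * t ^ 2 := by
    intro t
    -- `Y + t • H` need not be positive: the scalar remainder bound holds for all real eigenvalues.
    obtain ⟨U, p, hX⟩ := exists_eq_specMat (hY.isHermitian.add (hH.smul (IsSelfAdjoint.all t)))
    have hD := relEnt_specMat U V p q
    rw [← hX] at hD
    have hself : (Y * matLog Y).trace.re = vnEntropy Y := rfl
    have e1 : vnEntropy (Y + t • H) - vnEntropy Y - t * ((H * matLog Y).trace.re + H.trace.re) =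
        ∑ i, ∑ j, overlap U V i j *
          (p i * Real.log (p i) - p i * Real.log (q j) - p i + q j) := by
      rw [← hD, relEnt, Matrix.add_mul, trace_add, trace_add, Complex.add_re, Complex.add_re,
        Matrix.smul_mul, trace_smul, trace_smul, Complex.smul_re, Complex.smul_re, hself]
      simp only [smul_eq_mul, Y]
      ring
    have e2 : c * t ^ 2 = ∑ i, ∑ j, overlap U V i j * (p i - q j) ^ 2 := by
      have h1 := trace_specMat_mul_specMat U V p q
      have h3 : t • H = specMat U p - Y := by rw [← hX]; abel
      have h4 : c * t ^ 2 = ((t • H) * (t • H)).trace.re := by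
        rw [Matrix.smul_mul, Matrix.mul_smul, trace_smul, trace_smul, Complex.smul_re,
          Complex.smul_re]
        simp only [smul_eq_mul, c]
        ring
      rw [h4, h3, Matrix.sub_mul, Matrix.mul_sub, Matrix.mul_sub, trace_sub, trace_sub, trace_sub,
        trace_mul_comm Y (specMat U p), specMat_mul_specMat, specMat_mul_specMat, h1,
        trace_specMat, trace_specMat]
      simp only [Complex.sub_re, Complex.ofReal_re]
      rw [sum_eq_sum_overlap_left U V fun i => p i * p i,
        sum_eq_sum_overlap_right U V fun i => q i * q i]
      simp only [← Finset.sum_sub_distrib]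
      refine Finset.sum_congr rfl fun i _ => Finset.sum_congr rfl fun j _ => ?_
      ring
    rw [e1, mul_assoc, e2, Finset.mul_sum]
    refine (Finset.abs_sum_le_sum_abs _ _).trans (Finset.sum_le_sum fun i _ => ?_)
    rw [Finset.mul_sum]
    refine (Finset.abs_sum_le_sum_abs _ _).trans (Finset.sum_le_sum fun j _ => ?_)
    rw [abs_mul, abs_of_nonneg (overlap_nonneg U V i j)]
    have h1 := (abs_scalar_bregman_le (p i) (hq j)).trans
      (mul_le_mul_of_nonneg_right (hle j) (sq_nonneg (p i - q j)))
    have h2 := mul_le_mul_of_nonneg_left h1 (overlap_nonneg U V i j)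
    linarith
  rw [hasDerivAt_iff_isLittleO]
  refine (Asymptotics.IsBigO.of_bound (C * c)
    (Filter.Eventually.of_forall fun t => ?_)).trans_isLittleO (g := fun t : ℝ => t ^ 2) ?_
  · have := key t
    simpa using this
  · simpa using Asymptotics.isLittleO_pow_id (𝕜 := ℝ) one_lt_two

/-- The von Neumann regularizer generates the quantum relative entropy. -/
theorem bregman_vnEntropy {X Y : Matrix ι ι ℂ} (hX : X.IsHermitian) (hY : Y.PosDef)
    (h : X.trace = Y.trace) : bregman vnEntropy X Y = relEnt X Y := by
  have hd := (hasDerivAt_vnEntropy hY (hX.sub hY.isHermitian)).deriv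
  rw [bregman, lineDeriv, hd, relEnt, Matrix.sub_mul, trace_sub, trace_sub, h, sub_self,
    Complex.sub_re, Complex.zero_re]
  change _ - (Y * matLog Y).trace.re - _ = _
  ring

end Derivative

theorem isStronglyConvex_vnEntropy (k : ℕ) : IsStronglyConvex k vnEntropy 1 := by
  intro X hX Y hY hY'
  rw [bregman_vnEntropy hX.1.isHermitian hY' (hX.2.trans hY.2.symm)]
  exact traceNorm_sq_le_relEnt hX.1 hY' hX.2 hY.2

/-! ### Logit maps, proximal steps and the one-step estimate -/

section Logit

variable {ι : Type*} [Fintype ι] [DecidableEq ι]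

theorem logit_specMat (U : unitaryGroup ι ℂ) (d : ι → ℝ) :
    logit (specMat U d) = specMat U (fun i => (∑ j, Real.exp (d j))⁻¹ * Real.exp (d i)) := by
  rw [logit, exp_specMat, trace_specMat, ← Complex.ofReal_inv, ← smul_specMat]
  ext i j
  simp

theorem relEnt_self (X : Matrix ι ι ℂ) : relEnt X X = 0 := sub_self _

variable [Nonempty ι]

theorem posDef_logit {Y : Matrix ι ι ℂ} (hY : Y.IsHermitian) : (logit Y).PosDef := by
  obtain ⟨U, d, rfl⟩ := exists_eq_specMat hY
  rw [logit_specMat, posDef_specMat]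
  intro i
  have : 0 < ∑ j, Real.exp (d j) :=
    Finset.sum_pos (fun j _ => Real.exp_pos _) Finset.univ_nonempty
  positivity

theorem trace_logit {Y : Matrix ι ι ℂ} (hY : Y.IsHermitian) : (logit Y).trace = 1 := by
  obtain ⟨U, d, rfl⟩ := exists_eq_specMat hY
  have : 0 < ∑ j, Real.exp (d j) :=
    Finset.sum_pos (fun j _ => Real.exp_pos _) Finset.univ_nonempty
  rw [logit_specMat, trace_specMat, ← Finset.mul_sum, inv_mul_cancel₀ this.ne', Complex.ofReal_one]

theorem exists_matLog_logit {Y : Matrix ι ι ℂ} (hY : Y.IsHermitian) :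
    ∃ c : ℝ, matLog (logit Y) = Y - c • 1 := by
  obtain ⟨U, d, rfl⟩ := exists_eq_specMat hY
  have hZ : 0 < ∑ j, Real.exp (d j) :=
    Finset.sum_pos (fun j _ => Real.exp_pos _) Finset.univ_nonempty
  refine ⟨Real.log (∑ j, Real.exp (d j)), ?_⟩
  rw [logit_specMat, matLog_specMat, eq_sub_iff_add_eq, ← specMat_const U, specMat_add]
  congr 1
  ext i
  rw [Real.log_mul (inv_ne_zero hZ.ne') (Real.exp_pos _).ne', Real.log_inv, Real.log_exp]
  ring

/-- A logit step from `P` along `D` tilts the relative entropy by a linear function, up to a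
normalizing constant. -/
theorem exists_relEnt_logit {P D : Matrix ι ι ℂ} (hP : P.IsHermitian) (hD : D.IsHermitian)
    (η : ℝ) : ∃ c : ℝ, ∀ C : Matrix ι ι ℂ, C.trace = 1 →
      relEnt C (logit (matLog P + η • D)) = relEnt C P - η * (D * C).trace.re + c := by
  obtain ⟨c, hc⟩ := exists_matLog_logit
    ((isHermitian_matLog hP).add (hD.smul (IsSelfAdjoint.all η)))
  refine ⟨c, fun C hC => ?_⟩
  rw [relEnt, relEnt, hc, Matrix.mul_sub, Matrix.mul_add, Matrix.mul_smul, Matrix.mul_smul,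
    Matrix.mul_one, trace_sub, trace_add, trace_smul, trace_smul, hC, trace_mul_comm C D]
  simp
  ring

end Logit

section Prox

variable {k : ℕ}

theorem logit_mem_spectraplex {Y : QMat k} (hY : Y.IsHermitian) : logit Y ∈ spectraplex k :=
  ⟨(posDef_logit hY).posSemidef, trace_logit hY⟩

theorem relEnt_nonneg {X Y : QMat k} (hX : X ∈ spectraplex k) (hY : Y ∈ spectraplex k)
    (hY' : Y.PosDef) : 0 ≤ relEnt X Y :=
  le_trans (by positivity) (traceNorm_sq_le_relEnt hX.1 hY' hX.2 hY.2)

theorem eq_of_relEnt_nonpos {X Y : QMat k} (hX : X ∈ spectraplex k) (hY : Y ∈ spectraplex k)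
    (hY' : Y.PosDef) (h : relEnt X Y ≤ 0) : X = Y := by
  have h1 := traceNorm_sq_le_relEnt hX.1 hY' hX.2 hY.2
  have h2 : traceNorm (X - Y) ^ 2 = 0 := le_antisymm (by linarith) (sq_nonneg _)
  exact sub_eq_zero.1 (eq_zero_of_traceNorm_eq_zero (hX.1.isHermitian.sub hY.1.isHermitian)
    (pow_eq_zero_iff two_ne_zero |>.1 h2))

/-- Up to an additive constant, the proximal objective at `C` is `1/η` times the relative entropy of
`C` with respect to the logit point, so the latter is its unique minimizer. -/
theorem isProx_vnEntropy_iff {X Y : QMat k} {η : ℝ} (hX : X ∈ spectraplex k) (hX' : X.PosDef)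
    (hY : Y.IsHermitian) (hη : 0 < η) (Q : QMat k) :
    IsProx vnEntropy η X Y Q ↔ Q = logit (matLog X + η • Y) := by
  have hL : (matLog X + η • Y).IsHermitian :=
    (isHermitian_matLog hX'.isHermitian).add (hY.smul (IsSelfAdjoint.all η))
  obtain ⟨c, hc⟩ := exists_relEnt_logit hX'.isHermitian hY η
  set L := logit (matLog X + η • Y)
  have hLs : L ∈ spectraplex k := logit_mem_spectraplex hL
  have hLp : L.PosDef := posDef_logit hL
  have obj : ∀ C ∈ spectraplex k,
      (Yᴴ * (X - C)).trace.re + 1 / η * bregman vnEntropy C X =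
        (Y * X).trace.re + 1 / η * (relEnt C L - c) := by
    intro C hC
    rw [bregman_vnEntropy hC.1.isHermitian hX' (hC.2.trans hX.2.symm), hc C hC.2, hY.eq,
      Matrix.mul_sub, trace_sub, Complex.sub_re]
    field_simp
    ring
  have hη' : 0 < 1 / η := by positivity
  constructor
  · rintro ⟨hQ, hmin⟩
    have h := hmin L hLs
    rw [obj Q hQ, obj L hLs, relEnt_self, add_le_add_iff_left, mul_le_mul_iff_right₀ hη'] at h
    exact eq_of_relEnt_nonpos hQ hLs hLp (by linarith)
  · rintro rfl
    refine ⟨hLs, fun C hC => ?_⟩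
    rw [obj C hC, obj L hLs, relEnt_self, add_le_add_iff_left, mul_le_mul_iff_right₀ hη']
    linarith [relEnt_nonneg hC hLs hLp]

theorem maxMixed_eq_specMat (k : ℕ) : maxMixed k = specMat 1 (fun _ => ((2 : ℝ) ^ k)⁻¹) := by
  rw [specMat_const, maxMixed]
  ext i j
  simp

theorem posDef_maxMixed (k : ℕ) : (maxMixed k).PosDef := by
  rw [maxMixed_eq_specMat, posDef_specMat]
  intro; positivity

theorem maxMixed_mem_spectraplex (k : ℕ) : maxMixed k ∈ spectraplex k := by
  refine ⟨(posDef_maxMixed k).posSemidef, ?_⟩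
  rw [maxMixed_eq_specMat, trace_specMat]
  simp

/-- Every state has relative entropy at most `k log 2` with respect to the maximally mixed one. -/
theorem relEnt_maxMixed_le {X : QMat k} (hX : X ∈ spectraplex k) :
    relEnt X (maxMixed k) ≤ k * Real.log 2 := by
  obtain ⟨U, p, rfl⟩ := exists_eq_specMat hX.1.isHermitian
  have hp := (posSemidef_specMat U p).1 hX.1
  have hp1 : ∑ i, p i = 1 := by have := hX.2; rw [trace_specMat] at this; exact_mod_cast this
  have hle : ∀ i, p i ≤ 1 := fun i =>
    hp1 ▸ Finset.single_le_sum (fun j _ => hp j) (Finset.mem_univ i)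
  have h1 : ∑ i, p i * Real.log (p i) ≤ 0 := Finset.sum_nonpos fun i _ =>
    mul_nonpos_of_nonneg_of_nonpos (hp i) (Real.log_nonpos (hp i) (hle i))
  rw [relEnt, vnEntropy_specMat, maxMixed_eq_specMat, matLog_specMat, specMat_const,
    Matrix.mul_smul, Matrix.mul_one, trace_smul, hX.2, Complex.smul_re, Complex.one_re,
    Real.log_inv, Real.log_pow, smul_eq_mul]
  linarith

/-- One step of optimistic mirror prox for one player. Both updates start at `Φ`, so the exact
three-point identities of the relative entropy leave only the drift `F' - F` of the feedback. -/
theorem optimistic_step {μ γ x : ℝ} (hμ : 0 < μ) (hγ : 0 < γ)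
    (hsc : IsStronglyConvex k vnEntropy μ) {Φ F F' : QMat k} (hΦ : Φ ∈ spectraplex k)
    (hΦ' : Φ.PosDef) (hF : F.IsHermitian) (hF' : F'.IsHermitian) (hx : opNorm (F' - F) ≤ γ * x)
    {Ψ' Φ₁ : QMat k} (hΨ' : Ψ' = logit (matLog Φ + (μ / (2 * γ)) • F))
    (hΦ₁ : Φ₁ = logit (matLog Φ + (μ / (2 * γ)) • F')) :
    traceNorm (Φ₁ - Ψ') ≤ x / 2 ∧ ∀ Z ∈ spectraplex k,
      μ / (2 * γ) * (F' * (Z - Ψ')).trace.re ≤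
        relEnt Z Φ - relEnt Z Φ₁ + μ / 8 * x ^ 2 - μ / 2 * traceNorm (Ψ' - Φ) ^ 2 := by
  have hη : 0 < μ / (2 * γ) := by positivity
  have hηγ : μ / (2 * γ) * γ = μ / 2 := by field_simp
  have hsc' : ∀ {A B : QMat k}, A ∈ spectraplex k → B ∈ spectraplex k → B.PosDef →
      μ / 2 * traceNorm (A - B) ^ 2 ≤ relEnt A B := by
    intro A B hA hB hB'
    rw [← bregman_vnEntropy hA.1.isHermitian hB' (hA.2.trans hB.2.symm)]
    exact hsc A hA B hB hB'
  generalize μ / (2 * γ) = η at *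
  have hL : ∀ {G : QMat k}, G.IsHermitian → (matLog Φ + η • G).IsHermitian := fun hG =>
    (isHermitian_matLog hΦ'.isHermitian).add (hG.smul (IsSelfAdjoint.all η))
  have hs : Ψ' ∈ spectraplex k := hΨ' ▸ logit_mem_spectraplex (hL hF)
  have hp : Ψ'.PosDef := hΨ' ▸ posDef_logit (hL hF)
  have hs₁ : Φ₁ ∈ spectraplex k := hΦ₁ ▸ logit_mem_spectraplex (hL hF')
  have hp₁ : Φ₁.PosDef := hΦ₁ ▸ posDef_logit (hL hF')
  obtain ⟨c, hc⟩ := exists_relEnt_logit hΦ'.isHermitian hF η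
  obtain ⟨c', hc'⟩ := exists_relEnt_logit hΦ'.isHermitian hF' η
  rw [← hΨ'] at hc
  rw [← hΦ₁] at hc'
  have a1 := hc Ψ' hs.2
  have a2 := hc Φ₁ hs₁.2
  have a3 := hc' Ψ' hs.2
  have a4 := hc' Φ₁ hs₁.2
  rw [relEnt_self] at a1 a4
  have hsum : relEnt Ψ' Φ₁ + relEnt Φ₁ Ψ' = η * ((F' - F) * (Φ₁ - Ψ')).trace.re := by
    rw [Matrix.sub_mul, Matrix.mul_sub, Matrix.mul_sub, trace_sub, trace_sub, trace_sub]
    simp only [Complex.sub_re]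
    linarith
  have hherm := hs₁.1.isHermitian.sub hs.1.isHermitian
  set y := traceNorm (Φ₁ - Ψ') with hy
  have hy0 : 0 ≤ y := traceNorm_nonneg hherm
  have hdrift : relEnt Ψ' Φ₁ + relEnt Φ₁ Ψ' ≤ μ / 2 * (x * y) := by
    rw [hsum, ← hηγ, mul_assoc]
    refine mul_le_mul_of_nonneg_left ?_ hη.le
    refine (le_abs_self _).trans ((abs_re_trace_mul_le _ hherm).trans ?_)
    rw [← mul_assoc]
    exact mul_le_mul_of_nonneg_right hx hy0
  have b1 : μ / 2 * y ^ 2 ≤ relEnt Φ₁ Ψ' := hsc' hs₁ hs hp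
  have b2 : μ / 2 * y ^ 2 ≤ relEnt Ψ' Φ₁ := by
    have := hsc' hs hs₁ hp₁
    rwa [traceNorm_sub_comm] at this
  refine ⟨?_, fun Z hZ => ?_⟩
  · rcases hy0.eq_or_lt with h0 | h0
    · rw [← h0]
      have : 0 ≤ γ * x := (opNorm_nonneg _).trans hx
      linarith [nonneg_of_mul_nonneg_right this hγ]
    · have h : μ / 2 * y * (2 * y) ≤ μ / 2 * y * x := by nlinarith
      have := le_of_mul_le_mul_left h (by positivity)
      linarith
  · have b3 := hsc' hs hΦ hΦ'
    have a5 := hc' Z hZ.2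
    rw [Matrix.mul_sub, trace_sub, Complex.sub_re]
    -- Removing `relEnt Φ₁ Ψ' ≥ μ / 2 * y ^ 2` from the drift leaves a quadratic in `y` that is
    -- maximal at `y = x / 2`.
    have : μ / 2 * (x * y) - μ / 2 * y ^ 2 ≤ μ / 8 * x ^ 2 := by
      nlinarith [mul_nonneg hμ.le (sq_nonneg (x - 2 * y))]
    linarith

end Prox

/-! ### The payoff gradients and their Lipschitz bound -/

section Contraction

open scoped Matrix.Norms.L2Operator in
theorem l2_opNorm_le_one_of_isometry {ι κ : Type*} [Fintype ι] [DecidableEq ι]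
    [Fintype κ] {J : Matrix κ ι ℂ} (hJ : Jᴴ * J = 1) : ‖J‖ ≤ 1 := by
  have h := l2_opNorm_conjTranspose_mul_self J
  have h1 : ‖(1 : Matrix ι ι ℂ)‖ ≤ 1 := opNorm_unitary_le (1 : unitaryGroup ι ℂ)
  rw [hJ] at h
  nlinarith [norm_nonneg J]

variable {ι κ : Type*} [Fintype ι] [DecidableEq ι] [Fintype κ] [DecidableEq κ]

open scoped Matrix.Norms.L2Operator in
/-- A combination of compressions of `K` by isometries is bounded by `‖K‖∞` times the `ℓ¹` norm of
the coefficients. -/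
theorem opNorm_sum_compression_le {σ : Type*} [Fintype σ] (K : Matrix κ κ ℂ)
    (J : σ → Matrix κ ι ℂ) (hJ : ∀ s, (J s)ᴴ * J s = 1) (q : σ → ℝ) :
    opNorm (∑ s, (q s : ℂ) • ((J s)ᴴ * K * J s)) ≤ opNorm K * ∑ s, |q s| := by
  rw [opNorm_eq_norm, opNorm_eq_norm, Finset.mul_sum]
  refine (norm_sum_le _ _).trans (Finset.sum_le_sum fun s _ => ?_)
  rw [norm_smul, Complex.norm_real, Real.norm_eq_abs, mul_comm]
  refine mul_le_mul_of_nonneg_right ?_ (abs_nonneg _)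
  have h1 := l2_opNorm_le_one_of_isometry (hJ s)
  have h2 : ‖(J s)ᴴ‖ ≤ 1 := by rwa [l2_opNorm_conjTranspose]
  calc ‖(J s)ᴴ * K * J s‖ ≤ ‖(J s)ᴴ * K‖ * ‖J s‖ := l2_opNorm_mul _ _
    _ ≤ ‖(J s)ᴴ‖ * ‖K‖ * ‖J s‖ := by gcongr; exact l2_opNorm_mul _ _
    _ ≤ 1 * ‖K‖ * 1 := by gcongr
    _ = ‖K‖ := by ring

open scoped Matrix.Norms.L2Operator in
theorem opNorm_neg (A : Matrix ι ι ℂ) : opNorm (-A) = opNorm A := by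
  rw [opNorm_eq_norm, opNorm_eq_norm, norm_neg]

theorem specMat_apply (V : unitaryGroup κ ℂ) (q : κ → ℝ) (c b : κ) :
    specMat V q c b =
      ∑ s, (q s : ℂ) * ((V : Matrix κ κ ℂ) c s * star ((V : Matrix κ κ ℂ) b s)) := by
  rw [specMat, mul_apply]
  refine Finset.sum_congr rfl fun s _ => ?_
  rw [mul_diagonal, conjTranspose_apply]
  ring

/-- Pairing the second factor of an operator on a product space with a Hermitian matrix `H` is a
combination of compressions, one for each eigenvector of `H`. -/
theorem opNorm_contract_right_le (K : Matrix (ι × κ) (ι × κ) ℂ) {H : Matrix κ κ ℂ}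
    (hH : H.IsHermitian) :
    opNorm (Matrix.of fun i i' => ∑ b, ∑ c, K (i, b) (i', c) * H c b) ≤
      opNorm K * traceNorm H := by
  obtain ⟨V, q, rfl⟩ := exists_eq_specMat hH
  -- `J s` is the isometry `x ↦ x ⊗ vₛ` for the `s`-th eigenvector `vₛ`.
  set J : κ → Matrix (ι × κ) ι ℂ := fun s =>
    Matrix.of fun x i => if x.1 = i then (V : Matrix κ κ ℂ) x.2 s else 0 with hJ
  have hJ1 : ∀ s, (J s)ᴴ * J s = 1 := by
    intro s
    have h := sum_norm_sq_col (conjTranspose_mul_unitary V) s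
    ext i i'
    rw [mul_apply, Fintype.sum_prod_type]
    simp only [hJ, conjTranspose_apply, of_apply, one_apply]
    by_cases hi : i = i'
    · subst hi
      simp only [if_true]
      rw [Finset.sum_eq_single i (fun a _ ha => by simp [ha]) (by simp)]
      simp only [if_true, RCLike.star_def, RCLike.conj_mul]
      have h' := congrArg Complex.ofReal h
      push_cast at h'
      exact h'
    · rw [if_neg hi]
      refine Finset.sum_eq_zero fun a _ => Finset.sum_eq_zero fun b _ => ?_
      by_cases ha : a = i
      · subst ha; simp [hi]
      · simp [ha]
  have e : (Matrix.of fun i i' => ∑ b, ∑ c, K (i, b) (i', c) * specMat V q c b) =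
      ∑ s, (q s : ℂ) • ((J s)ᴴ * K * J s) := by
    ext i i'
    have h1 : ∀ s, ((J s)ᴴ * K * J s) i i' = ∑ b, ∑ c, K (i, b) (i', c) *
        ((V : Matrix κ κ ℂ) c s * star ((V : Matrix κ κ ℂ) b s)) := by
      intro s
      rw [mul_apply, Fintype.sum_prod_type, Finset.sum_eq_single i' (fun a _ ha => by simp [hJ, ha])
        (by simp), Finset.sum_comm]
      refine Finset.sum_congr rfl fun c _ => ?_
      rw [mul_apply, Fintype.sum_prod_type, Finset.sum_eq_single i (fun a _ ha => by simp [hJ, ha])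
        (by simp), Finset.sum_mul]
      refine Finset.sum_congr rfl fun b _ => ?_
      simp only [hJ, conjTranspose_apply, of_apply, if_true]
      ring
    rw [of_apply, Matrix.sum_apply]
    simp only [Matrix.smul_apply, smul_eq_mul, h1, specMat_apply, Finset.mul_sum]
    rw [Finset.sum_comm (s := Finset.univ (α := κ)) (t := Finset.univ (α := κ))]
    conv_rhs => rw [Finset.sum_comm]
    rw [Finset.sum_comm]
    refine Finset.sum_congr rfl fun b _ => ?_
    conv_rhs => rw [Finset.sum_comm]
    refine Finset.sum_congr rfl fun c _ => Finset.sum_congr rfl fun s _ => ?_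
    ring
  rw [e, traceNorm_specMat]
  exact opNorm_sum_compression_le K J hJ1 q

theorem opNorm_contract_left_le (K : Matrix (ι × κ) (ι × κ) ℂ) {H : Matrix ι ι ℂ}
    (hH : H.IsHermitian) :
    opNorm (Matrix.of fun j j' => ∑ b, ∑ c, K (b, j) (c, j') * H c b) ≤
      opNorm K * traceNorm H := by
  -- Exchanging the two factors is the compression by a permutation matrix.
  set J : Matrix (ι × κ) (κ × ι) ℂ := (1 : Matrix (ι × κ) (ι × κ) ℂ).submatrix id Prod.swap with hJ
  have hJ1 : Jᴴ * J = 1 := by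
    ext x y
    simp [hJ, mul_apply, one_apply, Prod.swap_inj]
  have hJ2 : Jᴴ * K * J = K.submatrix Prod.swap Prod.swap := by
    ext x y
    simp [hJ, mul_apply, one_apply]
  have h := opNorm_sum_compression_le (σ := Unit) K (fun _ => J) (fun _ => hJ1) 1
  simp only [Finset.univ_unique, Finset.sum_singleton, Pi.one_apply, Complex.ofReal_one, one_smul,
    abs_one, mul_one, hJ2] at h
  exact (opNorm_contract_right_le (K.submatrix Prod.swap Prod.swap) hH).trans
    (mul_le_mul_of_nonneg_right h (traceNorm_nonneg hH))

end Contraction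

section Payoff

variable {n m : ℕ} {Ω : Type*} [Fintype Ω] (G : Game n m Ω)

theorem Game.isHermitian_payoff : G.payoff.IsHermitian := by
  unfold Game.payoff
  refine isSelfAdjoint_sum _ fun ω _ => ?_
  refine IsSelfAdjoint.smul ?_ (G.povm_posSemidef ω).isHermitian
  simp [IsSelfAdjoint]

/-- Contracting Bob's factor of the payoff observable with `β`, in coordinates. -/
theorem Game.gradA_apply (β : QMat m) (i i' : Fin (2 ^ n)) :
    G.gradA β i i' = ∑ b, ∑ c, G.payoff (i, b) (i', c) * β c b := by
  simp only [Game.gradA, ptraceB, of_apply, G.isHermitian_payoff.eq, mul_apply,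
    kroneckerMap_apply, Fintype.sum_prod_type]
  refine Finset.sum_congr rfl fun b _ => ?_
  rw [Finset.sum_eq_single i' (fun a _ ha => by simp [one_apply, ha]) (by simp)]
  simp

theorem Game.gradB_apply (α : QMat n) (j j' : Fin (2 ^ m)) :
    G.gradB α j j' = -∑ b, ∑ c, G.payoff (b, j) (c, j') * α c b := by
  simp only [Game.gradB, ptraceA, Matrix.neg_apply, of_apply, G.isHermitian_payoff.eq, mul_apply,
    kroneckerMap_apply, Fintype.sum_prod_type]
  congr 1
  refine Finset.sum_congr rfl fun b _ => Finset.sum_congr rfl fun c _ => ?_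
  rw [Finset.sum_eq_single j' (fun a _ ha => by simp [one_apply, ha]) (by simp)]
  simp

theorem Game.isHermitian_gradA {β : QMat m} (hβ : β.IsHermitian) : (G.gradA β).IsHermitian := by
  refine IsHermitian.ext fun i i' => ?_
  rw [G.gradA_apply, G.gradA_apply, Finset.sum_comm]
  simp only [star_sum, star_mul', G.isHermitian_payoff.apply, hβ.apply]

theorem Game.isHermitian_gradB {α : QMat n} (hα : α.IsHermitian) : (G.gradB α).IsHermitian := by
  refine IsHermitian.ext fun i i' => ?_
  rw [G.gradB_apply, G.gradB_apply, Finset.sum_comm]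
  simp only [star_neg, star_sum, star_mul', G.isHermitian_payoff.apply, hα.apply]

theorem Game.gradA_sub (β β' : QMat m) : G.gradA β - G.gradA β' = G.gradA (β - β') := by
  ext i i'
  simp only [Matrix.sub_apply, G.gradA_apply, mul_sub, Finset.sum_sub_distrib]

theorem Game.gradB_sub (α α' : QMat n) : G.gradB α - G.gradB α' = G.gradB (α - α') := by
  ext i i'
  simp only [Matrix.sub_apply, G.gradB_apply, mul_sub, Finset.sum_sub_distrib]
  ring

theorem Game.opNorm_gradA_le {β : QMat m} (hβ : β.IsHermitian) :
    opNorm (G.gradA β) ≤ opNorm G.payoff * traceNorm β := by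
  convert opNorm_contract_right_le G.payoff hβ using 2
  ext i i'
  exact G.gradA_apply β i i'

theorem Game.opNorm_gradB_le {α : QMat n} (hα : α.IsHermitian) :
    opNorm (G.gradB α) ≤ opNorm G.payoff * traceNorm α := by
  have h := opNorm_contract_left_le G.payoff hα
  rw [← opNorm_neg] at h
  convert h using 2
  ext i i'
  exact G.gradB_apply α i i'

theorem Game.isLipschitz_opNorm : G.IsLipschitz (opNorm G.payoff) := by
  intro Z hZ Z' hZ'
  have h1 := hZ.1.1.isHermitian.sub hZ'.1.1.isHermitian
  have h2 := hZ.2.1.isHermitian.sub hZ'.2.1.isHermitian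
  have h0 := opNorm_nonneg G.payoff
  refine max_le ?_ ?_
  · change opNorm (G.gradA Z.2 - G.gradA Z'.2) ≤ _
    rw [G.gradA_sub]
    exact (G.opNorm_gradA_le h2).trans
      (mul_le_mul_of_nonneg_left (le_add_of_nonneg_left (traceNorm_nonneg h1)) h0)
  · change opNorm (G.gradB Z.1 - G.gradB Z'.1) ≤ _
    rw [G.gradB_sub]
    exact (G.opNorm_gradB_le h1).trans
      (mul_le_mul_of_nonneg_left (le_add_of_nonneg_right (traceNorm_nonneg h2)) h0)

theorem Game.expUtil_eq_sum (α : QMat n) (β : QMat m) : G.expUtil α β =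
    (∑ i, ∑ j, ∑ i', ∑ j', G.payoff (i, j) (i', j') * (α i' i * β j' j)).re := by
  simp only [Game.expUtil, trace, diag_apply, G.isHermitian_payoff.eq, mul_apply,
    kroneckerMap_apply, Fintype.sum_prod_type]

theorem Game.trace_gradA_mul (α : QMat n) (β : QMat m) :
    (G.gradA β * α).trace.re = G.expUtil α β := by
  rw [G.expUtil_eq_sum]
  congr 1
  simp only [trace, diag_apply, mul_apply, G.gradA_apply, Finset.sum_mul]
  refine Finset.sum_congr rfl fun i _ => ?_
  rw [Finset.sum_comm]
  refine Finset.sum_congr rfl fun j _ => Finset.sum_congr rfl fun i' _ =>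
    Finset.sum_congr rfl fun j' _ => ?_
  ring

theorem Game.trace_gradB_mul (α : QMat n) (β : QMat m) :
    (G.gradB α * β).trace.re = -G.expUtil α β := by
  rw [G.expUtil_eq_sum, ← Complex.neg_re]
  congr 1
  simp only [trace, diag_apply, mul_apply, G.gradB_apply, neg_mul, Finset.sum_neg_distrib,
    Finset.sum_mul]
  congr 1
  conv_rhs => rw [Finset.sum_comm]
  refine Finset.sum_congr rfl fun j _ => ?_
  rw [Finset.sum_comm]
  refine Finset.sum_congr rfl fun i _ => ?_
  rw [Finset.sum_comm]
  refine Finset.sum_congr rfl fun i' _ => Finset.sum_congr rfl fun j' _ => ?_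
  ring

theorem traceNorm_eq_one {k : ℕ} {X : QMat k} (hX : X ∈ spectraplex k) : traceNorm X = 1 := by
  obtain ⟨U, p, rfl⟩ := exists_eq_specMat hX.1.isHermitian
  have hp := (posSemidef_specMat U p).1 hX.1
  have hp1 := hX.2
  rw [trace_specMat] at hp1
  rw [traceNorm_specMat, Finset.sum_congr rfl fun i _ => abs_of_nonneg (hp i)]
  exact_mod_cast hp1

theorem Game.abs_expUtil_le {α : QMat n} {β : QMat m} (hα : α ∈ spectraplex n)
    (hβ : β ∈ spectraplex m) : |G.expUtil α β| ≤ opNorm G.payoff := by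
  rw [← G.trace_gradA_mul]
  have h1 := abs_re_trace_mul_le (G.gradA β) hα.1.isHermitian
  have h2 := G.opNorm_gradA_le hβ.1.isHermitian
  rw [traceNorm_eq_one hα, mul_one] at h1
  rw [traceNorm_eq_one hβ, mul_one] at h2
  exact h1.trans h2

end Payoff

/-! ### The OMMWU run, its regret and average-iterate equilibria -/

section Run

variable {n m : ℕ} {Ω : Type*} [Fintype Ω] (G : Game n m Ω)

/-- Joint states both of whose components are positive definite. -/
def IsInterior (Z : Joint n m) : Prop :=
  Z ∈ jointStates n m ∧ Z.1.PosDef ∧ Z.2.PosDef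

theorem IsInterior.isHermitian_fst {Z : Joint n m} (hZ : IsInterior Z) : Z.1.IsHermitian :=
  hZ.2.1.isHermitian

theorem IsInterior.isHermitian_snd {Z : Joint n m} (hZ : IsInterior Z) : Z.2.IsHermitian :=
  hZ.2.2.isHermitian

theorem isInterior_maxMixed : IsInterior (maxMixed n, maxMixed m) :=
  ⟨⟨maxMixed_mem_spectraplex n, maxMixed_mem_spectraplex m⟩, posDef_maxMixed n, posDef_maxMixed m⟩

theorem Game.isInterior_expUpdate (η : ℝ) {Φ Z : Joint n m} (hΦ : IsInterior Φ)
    (hZ : IsInterior Z) : IsInterior (Game.expUpdate η Φ (G.grad Z)) := by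
  have h1 : (matLog Φ.1 + η • G.gradA Z.2).IsHermitian :=
    (isHermitian_matLog hΦ.isHermitian_fst).add
      ((G.isHermitian_gradA hZ.isHermitian_snd).smul (IsSelfAdjoint.all η))
  have h2 : (matLog Φ.2 + η • G.gradB Z.1).IsHermitian :=
    (isHermitian_matLog hΦ.isHermitian_snd).add
      ((G.isHermitian_gradB hZ.isHermitian_fst).smul (IsSelfAdjoint.all η))
  exact ⟨⟨logit_mem_spectraplex h1, logit_mem_spectraplex h2⟩, posDef_logit h1, posDef_logit h2⟩

theorem Game.ommwuState_succ (η : ℝ) (t : ℕ) : G.ommwuState η (t + 1) =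
    Game.expUpdate η (G.ommwuMomentum η t) (G.grad (G.ommwuState η t)) := rfl

theorem Game.ommwuMomentum_succ (η : ℝ) (t : ℕ) : G.ommwuMomentum η (t + 1) =
    Game.expUpdate η (G.ommwuMomentum η t) (G.grad (G.ommwuState η (t + 1))) := rfl

theorem Game.isInterior_ommwu (η : ℝ) (t : ℕ) :
    IsInterior (G.ommwuState η t) ∧ IsInterior (G.ommwuMomentum η t) := by
  induction t with
  | zero => exact ⟨isInterior_maxMixed, isInterior_maxMixed⟩
  | succ t ih =>
    have h : IsInterior (G.ommwuState η (t + 1)) := G.isInterior_expUpdate η ih.2 ih.1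
    exact ⟨h, G.isInterior_expUpdate η ih.2 h⟩

theorem Game.isProx_iff_expUpdate {η : ℝ} (hη : 0 < η) {Φ Z : Joint n m} (hΦ : IsInterior Φ)
    (hZ : IsInterior Z) (Q : Joint n m) :
    (IsProx vnEntropy η Φ.1 (G.grad Z).1 Q.1 ∧ IsProx vnEntropy η Φ.2 (G.grad Z).2 Q.2) ↔
      Q = Game.expUpdate η Φ (G.grad Z) := by
  have h1 := isProx_vnEntropy_iff hΦ.1.1 hΦ.2.1 (G.isHermitian_gradA hZ.isHermitian_snd) hη Q.1
  have h2 := isProx_vnEntropy_iff hΦ.1.2 hΦ.2.2 (G.isHermitian_gradB hZ.isHermitian_fst) hη Q.2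
  exact (and_congr h1 h2).trans (Prod.ext_iff : Q = Game.expUpdate η Φ (G.grad Z) ↔ _).symm

theorem Game.isOMMPRun_iff {η : ℝ} (hη : 0 < η) (Ψ Φ : ℕ → Joint n m) :
    G.IsOMMPRun vnEntropy vnEntropy η Ψ Φ ↔ Ψ = G.ommwuState η ∧ Φ = G.ommwuMomentum η := by
  constructor
  · rintro ⟨h0, h0', hstep⟩
    have key : ∀ t, Ψ t = G.ommwuState η t ∧ Φ t = G.ommwuMomentum η t := by
      intro t
      induction t with
      | zero => exact ⟨h0, h0'⟩
      | succ t ih =>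
        obtain ⟨a, b, c, d⟩ := hstep t
        have hI := G.isInterior_ommwu η t
        rw [ih.1, ih.2] at a b
        have e1 : Ψ (t + 1) = G.ommwuState η (t + 1) :=
          (G.isProx_iff_expUpdate hη hI.2 hI.1 _).1 ⟨a, b⟩
        rw [ih.2, e1] at c d
        exact ⟨e1, (G.isProx_iff_expUpdate hη hI.2 (G.isInterior_ommwu η (t + 1)).1 _).1 ⟨c, d⟩⟩
    exact ⟨funext fun t => (key t).1, funext fun t => (key t).2⟩
  · rintro ⟨rfl, rfl⟩
    refine ⟨rfl, rfl, fun t => ?_⟩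
    have hI := G.isInterior_ommwu η t
    have h1 := (G.isProx_iff_expUpdate hη hI.2 hI.1 _).2 (G.ommwuState_succ η t)
    have h2 := (G.isProx_iff_expUpdate hη hI.2 (G.isInterior_ommwu η (t + 1)).1 _).2
      (G.ommwuMomentum_succ η t)
    exact ⟨h1.1, h1.2, h2.1, h2.2⟩

end Run

section Regret

variable {n m : ℕ} {Ω : Type*} [Fintype Ω] (G : Game n m Ω)

theorem traceNorm_sub_self {ι : Type*} [Fintype ι] [DecidableEq ι] (X : Matrix ι ι ℂ) :
    traceNorm (X - X) = 0 := by
  have h : X - X = specMat 1 (fun _ : ι => (0 : ℝ)) := by rw [specMat_const, zero_smul, sub_self]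
  rw [h, traceNorm_specMat]
  simp

variable {G} in
theorem Game.IsLipschitz.gradA {γ : ℝ} (hG : G.IsLipschitz γ) {β β' : QMat m}
    (hβ : β ∈ spectraplex m) (hβ' : β' ∈ spectraplex m) :
    opNorm (G.gradA β - G.gradA β') ≤ γ * traceNorm (β - β') := by
  have h := hG (maxMixed n, β) ⟨maxMixed_mem_spectraplex n, hβ⟩
    (maxMixed n, β') ⟨maxMixed_mem_spectraplex n, hβ'⟩
  rw [traceNorm_sub_self, zero_add] at h
  exact (le_max_left _ _).trans h

variable {G} in
theorem Game.IsLipschitz.gradB {γ : ℝ} (hG : G.IsLipschitz γ) {α α' : QMat n}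
    (hα : α ∈ spectraplex n) (hα' : α' ∈ spectraplex n) :
    opNorm (G.gradB α - G.gradB α') ≤ γ * traceNorm (α - α') := by
  have h := hG (α, maxMixed m) ⟨hα, maxMixed_mem_spectraplex m⟩
    (α', maxMixed m) ⟨hα', maxMixed_mem_spectraplex m⟩
  rw [traceNorm_sub_self, add_zero] at h
  exact (le_max_right _ _).trans h

/-- The gap of the profile `Z'` against the deviations in `Z`: Alice's payoff when she deviates
to `Z.1`, minus her payoff when Bob deviates to `Z.2`. -/
noncomputable def Game.gap (Z Z' : Joint n m) : ℝ :=
  G.expUtil Z.1 Z'.2 - G.expUtil Z'.1 Z.2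

theorem Game.gap_eq_trace (Z Z' : Joint n m) :
    G.gap Z Z' = (G.gradA Z'.2 * (Z.1 - Z'.1)).trace.re +
      (G.gradB Z'.1 * (Z.2 - Z'.2)).trace.re := by
  rw [Matrix.mul_sub, Matrix.mul_sub, trace_sub, trace_sub, Complex.sub_re, Complex.sub_re,
    G.trace_gradA_mul, G.trace_gradA_mul, G.trace_gradB_mul, G.trace_gradB_mul, Game.gap]
  ring

/-- The recursion behind the telescoping. Here `x` and `w` are a player's current move and the
opponent's previous one, `y` is the distance from the player's last state to the last momentum, and
`z` the distance from that momentum to the current state. -/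
theorem sq_le_of_triangle {x y z w : ℝ} (hx : 0 ≤ x) (h : x ≤ z + y) (hy : y ≤ w / 2) :
    x ^ 2 / 2 ≤ z ^ 2 + w ^ 2 / 4 := by
  have h1 : x ^ 2 ≤ (z + w / 2) ^ 2 := pow_le_pow_left₀ hx (by linarith) 2
  nlinarith [sq_nonneg (z - w / 2)]

/-- The regret of optimistic matrix multiplicative weights telescopes: the drift of the feedback in
step `t + 1` costs at most `μ/8` times the decrease of the squared last moves. For `T = 0` the
truncated subtraction makes the last move zero. -/
theorem Game.sum_gap_le {μ γ : ℝ} (hμ : 0 < μ) (hγ : 0 < γ)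
    (hA : IsStronglyConvex n vnEntropy μ) (hB : IsStronglyConvex m vnEntropy μ)
    (hG : G.IsLipschitz γ) {Z : Joint n m} (hZ : Z ∈ jointStates n m) (T : ℕ) :
    let Ψ := G.ommwuState (μ / (2 * γ))
    let Φ := G.ommwuMomentum (μ / (2 * γ))
    traceNorm ((Φ T).1 - (Ψ T).1) ≤ traceNorm ((Ψ T).2 - (Ψ (T - 1)).2) / 2 ∧
    traceNorm ((Φ T).2 - (Ψ T).2) ≤ traceNorm ((Ψ T).1 - (Ψ (T - 1)).1) / 2 ∧
    μ / (2 * γ) * ∑ t ∈ Finset.range T, G.gap Z (Ψ (t + 1)) ≤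
      relEnt Z.1 (maxMixed n) + relEnt Z.2 (maxMixed m) - relEnt Z.1 (Φ T).1 - relEnt Z.2 (Φ T).2
        - μ / 8 * (traceNorm ((Ψ T).1 - (Ψ (T - 1)).1) ^ 2 +
          traceNorm ((Ψ T).2 - (Ψ (T - 1)).2) ^ 2) := by
  intro Ψ Φ
  have hIΨ : ∀ t, IsInterior (Ψ t) := fun t => (G.isInterior_ommwu _ t).1
  have hIΦ : ∀ t, IsInterior (Φ t) := fun t => (G.isInterior_ommwu _ t).2
  induction T with
  | zero =>
    have e1 : Φ 0 = Ψ 0 := rfl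
    have e2 : Φ 0 = (maxMixed n, maxMixed m) := rfl
    rw [← e1, e2]
    simp only [traceNorm_sub_self, Finset.range_zero, Finset.sum_empty]
    norm_num
  | succ T ih =>
    obtain ⟨ihA, ihB, ihS⟩ := ih
    rw [Nat.add_sub_cancel]
    obtain ⟨yA, sA⟩ := optimistic_step hμ hγ hA (hIΦ T).1.1 (hIΦ T).2.1
      (G.isHermitian_gradA (hIΨ T).isHermitian_snd)
      (G.isHermitian_gradA (hIΨ (T + 1)).isHermitian_snd)
      (hG.gradA (hIΨ (T + 1)).1.2 (hIΨ T).1.2)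
      (Ψ' := (Ψ (T + 1)).1) (Φ₁ := (Φ (T + 1)).1) rfl rfl
    obtain ⟨yB, sB⟩ := optimistic_step hμ hγ hB (hIΦ T).1.2 (hIΦ T).2.2
      (G.isHermitian_gradB (hIΨ T).isHermitian_fst)
      (G.isHermitian_gradB (hIΨ (T + 1)).isHermitian_fst)
      (hG.gradB (hIΨ (T + 1)).1.1 (hIΨ T).1.1)
      (Ψ' := (Ψ (T + 1)).2) (Φ₁ := (Φ (T + 1)).2) rfl rfl
    refine ⟨yA, yB, ?_⟩
    have sA := sA Z.1 hZ.1
    have sB := sB Z.2 hZ.2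
    have tA : traceNorm ((Ψ (T + 1)).1 - (Ψ T).1) ≤
        traceNorm ((Ψ (T + 1)).1 - (Φ T).1) + traceNorm ((Φ T).1 - (Ψ T).1) := by
      rw [← sub_add_sub_cancel (Ψ (T + 1)).1 (Φ T).1 (Ψ T).1]
      exact traceNorm_add_le ((hIΨ _).isHermitian_fst.sub (hIΦ _).isHermitian_fst)
        ((hIΦ _).isHermitian_fst.sub (hIΨ _).isHermitian_fst)
    have tB : traceNorm ((Ψ (T + 1)).2 - (Ψ T).2) ≤
        traceNorm ((Ψ (T + 1)).2 - (Φ T).2) + traceNorm ((Φ T).2 - (Ψ T).2) := by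
      rw [← sub_add_sub_cancel (Ψ (T + 1)).2 (Φ T).2 (Ψ T).2]
      exact traceNorm_add_le ((hIΨ _).isHermitian_snd.sub (hIΦ _).isHermitian_snd)
        ((hIΦ _).isHermitian_snd.sub (hIΨ _).isHermitian_snd)
    have rA := sq_le_of_triangle
      (traceNorm_nonneg ((hIΨ _).isHermitian_fst.sub (hIΨ _).isHermitian_fst)) tA ihA
    have rB := sq_le_of_triangle
      (traceNorm_nonneg ((hIΨ _).isHermitian_snd.sub (hIΨ _).isHermitian_snd)) tB ihB
    have r := mul_le_mul_of_nonneg_left (add_le_add rA rB) (half_pos hμ).le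
    rw [Finset.sum_range_succ, mul_add, G.gap_eq_trace, mul_add]
    linarith

end Regret

section Average

variable {n m : ℕ} {Ω : Type*} [Fintype Ω] (G : Game n m Ω)

theorem average_mem_spectraplex {k T : ℕ} (hT : 1 ≤ T) {s : ℕ → QMat k}
    (hs : ∀ t, s t ∈ spectraplex k) :
    (T : ℝ)⁻¹ • ∑ t ∈ Finset.range T, s t ∈ spectraplex k := by
  have hT' : (T : ℝ) ≠ 0 := by positivity
  refine ⟨(posSemidef_sum _ fun t _ => (hs t).1).smul (by positivity), ?_⟩
  rw [trace_smul, trace_sum, Finset.sum_congr rfl fun t _ => (hs t).2]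
  simp only [Finset.sum_const, Finset.card_range, nsmul_eq_mul, mul_one]
  rw [Complex.real_smul]
  push_cast
  exact inv_mul_cancel₀ (by exact_mod_cast hT')

theorem Game.expUtil_average_left (T : ℕ) (s : ℕ → QMat n) (β : QMat m) :
    G.expUtil ((T : ℝ)⁻¹ • ∑ t ∈ Finset.range T, s t) β =
      (T : ℝ)⁻¹ * ∑ t ∈ Finset.range T, G.expUtil (s t) β := by
  simp only [← G.trace_gradA_mul]
  rw [Matrix.mul_smul, trace_smul, Complex.smul_re, Matrix.mul_sum, trace_sum, Complex.re_sum,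
    smul_eq_mul]

theorem Game.expUtil_average_right (T : ℕ) (α : QMat n) (s : ℕ → QMat m) :
    G.expUtil α ((T : ℝ)⁻¹ • ∑ t ∈ Finset.range T, s t) =
      (T : ℝ)⁻¹ * ∑ t ∈ Finset.range T, G.expUtil α (s t) := by
  have h : ∀ β, G.expUtil α β = -(G.gradB α * β).trace.re := fun β => by
    rw [G.trace_gradB_mul, neg_neg]
  simp only [h]
  rw [Matrix.mul_smul, trace_smul, Complex.smul_re, Matrix.mul_sum, trace_sum, Complex.re_sum,
    smul_eq_mul, Finset.sum_neg_distrib, mul_neg]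

/-- A bound on the summed gaps, uniform in the deviations, makes the average an approximate
equilibrium: each of the two deviations is tested against the average itself. -/
theorem Game.isApproxNash_average {T : ℕ} (hT : 1 ≤ T) {ε : ℝ} {s : ℕ → Joint n m}
    (hs : ∀ t, s t ∈ jointStates n m)
    (h : ∀ Z ∈ jointStates n m,
      ∑ t ∈ Finset.range T, G.gap Z (s t) ≤ T * (ε * opNorm G.payoff)) :
    G.IsApproxNash ε ((T : ℝ)⁻¹ • ∑ t ∈ Finset.range T, s t) := by
  have hT' : (0 : ℝ) < T := by exact_mod_cast hT
  set A : Joint n m := (T : ℝ)⁻¹ • ∑ t ∈ Finset.range T, s t with hA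
  have e1 : A.1 = (T : ℝ)⁻¹ • ∑ t ∈ Finset.range T, (s t).1 := by
    rw [hA, Prod.smul_fst, Prod.fst_sum]
  have e2 : A.2 = (T : ℝ)⁻¹ • ∑ t ∈ Finset.range T, (s t).2 := by
    rw [hA, Prod.smul_snd, Prod.snd_sum]
  have hmem : A ∈ jointStates n m :=
    ⟨e1 ▸ average_mem_spectraplex hT fun t => (hs t).1,
      e2 ▸ average_mem_spectraplex hT fun t => (hs t).2⟩
  have key : ∀ Z ∈ jointStates n m, G.gap Z A ≤ ε * opNorm G.payoff := by
    intro Z hZ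
    have : G.gap Z A = (T : ℝ)⁻¹ * ∑ t ∈ Finset.range T, G.gap Z (s t) := by
      simp only [Game.gap]
      rw [Finset.sum_sub_distrib, mul_sub, e1, e2, G.expUtil_average_left,
        G.expUtil_average_right]
    rw [this, inv_mul_le_iff₀ hT']
    exact h Z hZ
  refine ⟨hmem, fun α hα => ?_, fun β hβ => ?_⟩
  · have := key (α, A.2) ⟨hα, hmem.2⟩
    simp only [Game.gap] at this
    linarith
  · have := key (A.1, β) ⟨hmem.1, hβ⟩
    simp only [Game.gap] at this
    linarith

theorem Game.abs_gap_le {Z Z' : Joint n m} (hZ : Z ∈ jointStates n m)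
    (hZ' : Z' ∈ jointStates n m) : |G.gap Z Z'| ≤ 2 * opNorm G.payoff := by
  have h1 := G.abs_expUtil_le hZ.1 hZ'.2
  have h2 := G.abs_expUtil_le hZ'.1 hZ.2
  rw [Game.gap]
  exact (abs_sub _ _).trans (by linarith)

/-- There is a single state of zero qubits, where the claimed rate leaves no room for an error. -/
theorem spectraplex_zero_subsingleton {X Y : QMat 0} (hX : X ∈ spectraplex 0)
    (hY : Y ∈ spectraplex 0) : X = Y := by
  have h1 := hX.2
  have h2 := hY.2
  ext i j
  rw [trace, Fintype.sum_eq_single i fun x hx => (hx (by fin_omega)).elim] at h1 h2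
  have : j = i := by fin_omega
  rw [this]
  exact h1.trans h2.symm

theorem Game.gap_sub_gap_le {Z A B : Joint n m} (hZ : Z ∈ jointStates n m)
    (hA : A ∈ jointStates n m) (hB : B ∈ jointStates n m) :
    G.gap Z A - G.gap Z B ≤ 4 * (max n m : ℕ) * opNorm G.payoff := by
  rcases Nat.eq_zero_or_pos (max n m) with h | h
  · obtain rfl : n = 0 := by omega
    obtain rfl : m = 0 := by omega
    have : A = B := Prod.ext (spectraplex_zero_subsingleton hA.1 hB.1)
      (spectraplex_zero_subsingleton hA.2 hB.2)
    simp [this]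
  · have h1 := abs_le.1 (G.abs_gap_le hZ hA)
    have h2 := abs_le.1 (G.abs_gap_le hZ hB)
    have h3 : (1 : ℝ) ≤ (max n m : ℕ) := by exact_mod_cast h
    nlinarith [opNorm_nonneg G.payoff]

theorem Game.isApproxNash_ommwu {μ γ ε : ℝ} (hμ : 1 ≤ μ)
    (hA : IsStronglyConvex n vnEntropy μ) (hB : IsStronglyConvex m vnEntropy μ) (hγ : 0 < γ)
    (hγU : γ ≤ opNorm G.payoff) (hG : G.IsLipschitz γ) (hε : 0 < ε) {T : ℕ} (hT : 1 ≤ T)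
    (hTε : 8 * (max n m : ℕ) / ε ≤ T) :
    G.IsApproxNash ε (G.ommwuAverage (μ / (2 * γ)) T) ∧
      G.IsApproxNash ε (G.ommwuShiftedAverage (μ / (2 * γ)) T) := by
  have hμ0 : 0 < μ := one_pos.trans_le hμ
  set d : ℕ := max n m with hd
  set N := opNorm G.payoff with hN
  have hN0 : 0 ≤ N := opNorm_nonneg _
  set Ψ := G.ommwuState (μ / (2 * γ)) with hΨ
  have hstates : ∀ t, Ψ t ∈ jointStates n m := fun t => (G.isInterior_ommwu _ t).1.1
  have hbudget : 8 * d * N ≤ T * (ε * N) := by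
    rw [div_le_iff₀ hε] at hTε
    have := mul_le_mul_of_nonneg_right hTε hN0
    linarith
  have hd0 : (0 : ℝ) ≤ d := Nat.cast_nonneg d
  have hshift : ∀ Z ∈ jointStates n m,
      ∑ t ∈ Finset.range T, G.gap Z (Ψ (t + 1)) ≤ 4 * d * N := by
    intro Z hZ
    have hI := (G.isInterior_ommwu (μ / (2 * γ)) T).2
    have hS := (G.sum_gap_le hμ0 hγ hA hB hG hZ T).2.2
    have h1 := relEnt_maxMixed_le hZ.1
    have h2 := relEnt_maxMixed_le hZ.2
    have h3 := relEnt_nonneg hZ.1 hI.1.1 hI.2.1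
    have h4 := relEnt_nonneg hZ.2 hI.1.2 hI.2.2
    have hlog : Real.log 2 ≤ 1 := by linarith [Real.log_two_lt_d9]
    have hlog0 : 0 ≤ Real.log 2 := Real.log_nonneg one_le_two
    have hn : (n : ℝ) ≤ d := by exact_mod_cast le_max_left n m
    have hm : (m : ℝ) ≤ d := by exact_mod_cast le_max_right n m
    have h5 : (n : ℝ) * Real.log 2 ≤ d := by nlinarith [Nat.cast_nonneg (α := ℝ) n]
    have h6 : (m : ℝ) * Real.log 2 ≤ d := by nlinarith [Nat.cast_nonneg (α := ℝ) m]
    have h7 : μ / (2 * γ) * ∑ t ∈ Finset.range T, G.gap Z (Ψ (t + 1)) ≤ 2 * d := by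
      refine hS.trans ?_
      have : 0 ≤ μ / 8 * (traceNorm ((G.ommwuState (μ / (2 * γ)) T).1 -
            (G.ommwuState (μ / (2 * γ)) (T - 1)).1) ^ 2 +
          traceNorm ((G.ommwuState (μ / (2 * γ)) T).2 -
            (G.ommwuState (μ / (2 * γ)) (T - 1)).2) ^ 2) := by positivity
      linarith
    have h8 : μ / (2 * γ) * (4 * d * N) = 2 * d * (μ * (N / γ)) := by
      field_simp
      ring
    have h9 : 1 ≤ μ * (N / γ) := by
      have : 1 ≤ N / γ := (one_le_div hγ).2 hγU
      nlinarith
    refine le_of_mul_le_mul_left (h7.trans ?_) (by positivity : 0 < μ / (2 * γ))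
    rw [h8]
    nlinarith
  constructor
  -- The unshifted sum gains the gap of `Ψ 0` and loses that of `Ψ T`, which costs at most
  -- another `4 d ‖U‖∞`.
  · refine G.isApproxNash_average hT hstates fun Z hZ => ?_
    have e : ∑ t ∈ Finset.range T, G.gap Z (Ψ t) =
        ∑ t ∈ Finset.range T, G.gap Z (Ψ (t + 1)) + (G.gap Z (Ψ 0) - G.gap Z (Ψ T)) := by
      have h1 := Finset.sum_range_succ (fun t => G.gap Z (Ψ t)) T
      have h2 := Finset.sum_range_succ' (fun t => G.gap Z (Ψ t)) T
      linarith
    have h1 := hshift Z hZ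
    have h2 := G.gap_sub_gap_le hZ (hstates 0) (hstates T)
    rw [e]
    linarith
  · refine G.isApproxNash_average hT (fun t => hstates (t + 1)) fun Z hZ => ?_
    have := hshift Z hZ
    nlinarith [mul_nonneg hd0 hN0]

end Average

end QZS

/-- Iteration complexity of Optimistic Matrix Multiplicative Weights Update. -/
theorem mainTheorem2 :
    -- the proximal map of the von Neumann entropy is the logit map
    (∀ (k : ℕ) (X Y : QZS.QMat k) (η : ℝ),
      X ∈ QZS.spectraplex k → X.PosDef → Y.IsHermitian → 0 < η →
      ∀ Q : QZS.QMat k,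
        QZS.IsProx QZS.vnEntropy η X Y Q ↔ Q = QZS.logit (QZS.matLog X + η • Y)) ∧
    -- the OMMWU sequence is the unique run of OMMP with the von Neumann entropy
    (∀ (n m : ℕ) (Ω : Type*) [Fintype Ω] (G : QZS.Game n m Ω) (η : ℝ), 0 < η →
      ∀ Ψ Φ : ℕ → QZS.Joint n m,
        G.IsOMMPRun QZS.vnEntropy QZS.vnEntropy η Ψ Φ ↔
          Ψ = G.ommwuState η ∧ Φ = G.ommwuMomentum η) ∧
    -- `1` is a strong convexity parameter, and `‖U‖∞` a Lipschitz parameter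
    (∀ k : ℕ, QZS.IsStronglyConvex k QZS.vnEntropy 1) ∧
    (∀ (n m : ℕ) (Ω : Type*) [Fintype Ω] (G : QZS.Game n m Ω),
      G.IsLipschitz (QZS.opNorm G.payoff)) ∧
    -- with the step size `μ / (2γ)`, `O(d / ε)` iterations suffice
    ∃ K : ℝ, 0 < K ∧
      ∀ (n m : ℕ) (Ω : Type*) [Fintype Ω] (G : QZS.Game n m Ω) (μ γ ε : ℝ),
        1 ≤ μ → QZS.IsStronglyConvex n QZS.vnEntropy μ → QZS.IsStronglyConvex m QZS.vnEntropy μ →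
        0 < γ → γ ≤ QZS.opNorm G.payoff → G.IsLipschitz γ →
        0 < ε →
        ∀ T : ℕ, 1 ≤ T → K * (max n m : ℕ) / ε ≤ T →
          G.IsApproxNash ε (G.ommwuAverage (μ / (2 * γ)) T) ∧
          G.IsApproxNash ε (G.ommwuShiftedAverage (μ / (2 * γ)) T) := by
  exact ⟨fun k X Y η hX hX' hY hη Q => QZS.isProx_vnEntropy_iff hX hX' hY hη Q,
    fun n m Ω _ G η hη Ψ Φ => G.isOMMPRun_iff hη Ψ Φ,
    QZS.isStronglyConvex_vnEntropy,
    fun n m Ω _ G => G.isLipschitz_opNorm,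
    8, by norm_num, fun n m Ω _ G μ γ ε hμ hA hB hγ hγU hG hε T hT hTε =>
      G.isApproxNash_ommwu hμ hA hB hγ hγU hG hε hT hTε⟩
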